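/- **Model.** In slotted time, $N$ FIFO queues share one wireless medium; queue $n$ carries a finite set $\mathcal K_n$ of flows. Flow $k$ of queue $n$ brings $\lambda_{n,k}(t)\ge 0$ packets in slot $t$; the arrival vectors are i.i.d. over slots, with $E[\lambda_{n,k}(t)]=\lambda_{n,k}$ and $E[\lambda_{n,k}(t)^2]<\infty$. The link from queue $n$ to the receiver of flow $k$ is ON in slot $t$ with probability $\bar p_{n,k}\in(0,1]$ and OFF with probability $p_{n,k}=1-\bar p_{n,k}$; link states are independent over slots and across queues. Queue $n$ always has a head-of-line flow $H_n(t)\in\mathcal K_n$, and its state $S_n(t)$ is the state of the link of $H_n(t)$. A *queue-state policy* is a family $\tau_n(S_1,\dots,S_N)\ge 0$ with $\sum_n\tau_n(S_1,\dots,S_N)\le 1$ for each $(S_1,\dots,S_N)\in\mathcal S=\{ON,OFF\}^N$: in each slot at most one queue is selected, queue $n$ with probability $\tau_n(S_1(t),\dots,S_N(t))$, and the selected queue is served if its state is ON. When queue $n$ is served, its head is replaced by a packet that belongs to flow $k$ with probability $\alpha_{n,k}=\lambda_{n,k}/\sum_{l\in\mathcal K_n}\lambda_{n,l}$, independently of the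 past heads, link states and scheduling decisions; otherwise the head stays. The initial heads are independent of all later link states, scheduling decisions and new heads. With $g_n(t)=1$ if queue $n$ is served in slot $t$ and $g_n(t)=0$ otherwise, the queue size satisfies $Q_n(t+1)=\max[Q_n(t)-g_n(t),0]+\sum_{k\in\mathcal K_n}\lambda_{n,k}(t)$, where $Q_n(0)\ge0$ is integrable. The network is *stable* if $E[Q_n(t)]/t\to 0$ for every $n$, and *strongly stable* if $\sup_{T\ge1}\frac1T\sum_{t<T}E[Q_n(t)]<\infty$ for every $n$. Assume $\lambda_{n,k}\ge 0$ and $\sum_{k\in\mathcal K_n}\lambda_{n,k}>0$ for every $n$, and that either all $p_{n,k}>0$ or the Markov chain $(H_1(t),\dots,H_N(t))$ has a unique stationary distribution. **Theorem.** Let $\tau$ be a queue-state policy. Among the rate vectors just described, the stability region under $\tau$ consists exactly of those that satisfy, for all $n$ and all $k\in\mathcal K_n$, $$\lambda_{n,k}\ \le\ \sum_{(S_1,\dots,S_N)\in\mathcal S}\frac{\lambda_{n,k}\,1_{[S_n]}}{\sum_{l\in\mathcal K_n}\lambda_{n,l}/\bar p_{n,l}}\ \prod_{m\ne n}\psi_m(S_m)\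 \tau_n(S_1,\dots,S_N),\qquad \psi_m(S_m)=\frac{\sum_{k\in\mathcal K_m}\lambda_{m,k}\,\rho_{m,k}(S_m)}{\sum_{k\in\mathcal K_m}\lambda_{m,k}/\bar p_{m,k}},\qquad(*)$$ where $1_{[S_n]}$ is $1$ if $S_n=ON$ and $0$ if $S_n=OFF$, and $\rho_{m,k}(S_m)$ is $1$ if $S_m=ON$ and $p_{m,k}/\bar p_{m,k}$ if $S_m=OFF$. More precisely, for every such rate vector, the network (in each of its realizations) is stable if and only if $(*)$ holds for all $n,k$; if it is strongly stable then $(*)$ holds for all $n,k$; and if $(*)$ holds with strict inequality for all $n,k$ with $\lambda_{n,k}>0$, then it is strongly stable. -/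

import Mathlib

open MeasureTheory ProbabilityTheory Filter Topology

noncomputable section

namespace FifoWireless

variable {N : ℕ} {K : Fin N → ℕ}

/-! There are `N` queues; queue `n` is shared by `K n` flows. A family indexed by all flows has
type `∀ n, Fin (K n) → _`. The states ON and OFF are `true` and `false`. -/

/-- `1_[S]`: one if the state is ON, zero if it is OFF. -/
def onIndicator (b : Bool) : ℝ := if b then 1 else 0

/-- `ρ(S)` of a link whose ON probability is `pb`: one if ON, `(1 - pb) / pb` if OFF. -/
def rho (pb : ℝ) (b : Bool) : ℝ := if b then 1 else (1 - pb) / pb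

/-- `ψ_m(S_m) = (∑_k λ_{m,k} ρ_{m,k}(S_m)) / (∑_k λ_{m,k} / p̄_{m,k})`. -/
def psi (pbar lam : ∀ n, Fin (K n) → ℝ) (m : Fin N) (b : Bool) : ℝ :=
  (∑ k, lam m k * rho (pbar m k) b) / (∑ k, lam m k / pbar m k)

/-- The right-hand side of the rate constraint of flow `k` of queue `n`. -/
def rateBound (pbar lam : ∀ n, Fin (K n) → ℝ) (τ : Fin N → (Fin N → Bool) → ℝ)
    (n : Fin N) (k : Fin (K n)) : ℝ :=
  ∑ S : Fin N → Bool,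
    (lam n k * onIndicator (S n) / (∑ l, lam n l / pbar n l)) *
      (∏ m ∈ Finset.univ.erase n, psi pbar lam m (S m)) * τ n S

/-- Flow rates: nonnegative, and every queue carries some traffic. -/
def IsTraffic (lam : ∀ n, Fin (K n) → ℝ) : Prop :=
  (∀ n k, 0 ≤ lam n k) ∧ ∀ n, 0 < ∑ k, lam n k

/-- A queue-state policy: in joint state `S` a packet of queue `n` is transmitted with
probability `τ n S`, and at most one queue is served. -/
def IsQueueStatePolicy (τ : Fin N → (Fin N → Bool) → ℝ) : Prop :=
  (∀ n S, 0 ≤ τ n S) ∧ ∀ S, ∑ n, τ n S ≤ 1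

/-- `α_{n,k}`, the probability that a new head-of-line packet of queue `n` is of flow `k`. -/
def alpha (lam : ∀ n, Fin (K n) → ℝ) (n : Fin N) (k : Fin (K n)) : ℝ :=
  lam n k / ∑ l, lam n l

/-- One-slot transition probability of the vector of head-of-line flows, from `h` to `h'`: the
queues get the joint state `S` (independently, queue `n` being ON with probability
`p̄_{n, h n}`), and with probability `1_[S n] τ n S` the head of queue `n` is replaced by a fresh
packet. -/
def holTransition (pbar lam : ∀ n, Fin (K n) → ℝ) (τ : Fin N → (Fin N → Bool) → ℝ)
    (h h' : ∀ n, Fin (K n)) : ℝ :=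
  ∑ S : Fin N → Bool,
    (∏ n, if S n then pbar n (h n) else 1 - pbar n (h n)) *
      ((∑ n, onIndicator (S n) * τ n S *
          (if h' = Function.update h n (h' n) then alpha lam n (h' n) else 0)) +
        (1 - ∑ n, onIndicator (S n) * τ n S) * (if h' = h then 1 else 0))

/-- `w` is a stationary distribution of the head-of-line chain. -/
def IsSteadyState (pbar lam : ∀ n, Fin (K n) → ℝ) (τ : Fin N → (Fin N → Bool) → ℝ)
    (w : (∀ n, Fin (K n)) → ℝ) : Prop :=
  (∀ h, 0 ≤ w h) ∧ ∑ h, w h = 1 ∧ ∀ h', ∑ h, w h * holTransition pbar lam τ h h' = w h'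

/-- Steady-state probabilities are meaningful: either every link is OFF with positive
probability, or the head-of-line chain has no two different stationary distributions. -/
def IsRegular (pbar lam : ∀ n, Fin (K n) → ℝ) (τ : Fin N → (Fin N → Bool) → ℝ) : Prop :=
  (∀ n k, pbar n k < 1) ∨
    ∀ w w', IsSteadyState pbar lam τ w → IsSteadyState pbar lam τ w' → w = w'

/-- A realization, on a probability space, of the network with ON probabilities `pbar`, arrival
rates `lam` and queue-state policy `τ`. It consists of the initial data and, for each slot `t`, of
the arrivals, the link states, the scheduling decision and the flow of the packet that moves to
the head of each queue if its present head is transmitted. Nothing is assumed on the joint law of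
the arrivals and the other data. -/
structure Network (pbar lam : ∀ n, Fin (K n) → ℝ) (τ : Fin N → (Fin N → Bool) → ℝ)
    {Ω : Type*} [MeasurableSpace Ω] (μ : Measure Ω) where
  /-- `arr t ω n k`: amount of flow `k` that arrives to queue `n` in slot `t`. -/
  arr : ℕ → Ω → ∀ n, Fin (K n) → ℝ
  /-- `chan t ω n k`: state of the link from queue `n` to the receiver of flow `k`. -/
  chan : ℕ → Ω → ∀ n, Fin (K n) → Bool
  /-- `grant t ω S n`: whether the medium is given to queue `n` if the joint state is `S`. -/
  grant : ℕ → Ω → (Fin N → Bool) → Fin N → Bool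
  /-- `fresh t ω n`: flow of the packet that follows the head of queue `n`. -/
  fresh : ℕ → Ω → ∀ n, Fin (K n)
  /-- Head-of-line flows at time zero. -/
  hol0 : Ω → ∀ n, Fin (K n)
  /-- Queue sizes at time zero. -/
  backlog0 : Ω → Fin N → ℝ
  measurable_arr : ∀ t, Measurable (arr t)
  measurable_chan : ∀ t, Measurable (chan t)
  measurable_grant : ∀ t, Measurable (grant t)
  measurable_fresh : ∀ t, Measurable (fresh t)
  measurable_hol0 : Measurable hol0
  backlog0_nonneg : ∀ ω n, 0 ≤ backlog0 ω n
  integrable_backlog0 : ∀ n, Integrable (fun ω => backlog0 ω n) μ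
  /- Arrivals: i.i.d. over slots, of mean `lam`, with finite second moments. -/
  arr_nonneg : ∀ t ω n k, 0 ≤ arr t ω n k
  arr_indep : iIndepFun arr μ
  arr_ident : ∀ t, IdentDistrib (arr t) (arr 0) μ μ
  arr_memLp : ∀ t n k, MemLp (fun ω => arr t ω n k) 2 μ
  arr_mean : ∀ t n k, ∫ ω, arr t ω n k ∂μ = lam n k
  /- Independence over slots, and of the initial heads, of all that drives the heads. -/
  drive_indep : iIndepFun (fun t ω => (chan t ω, grant t ω, fresh t ω)) μ
  hol0_indep : IndepFun hol0 (fun ω t => (chan t ω, grant t ω, fresh t ω)) μ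
  /- Links: ON with probability `pbar`; links of different queues are independent. -/
  chan_prob : ∀ t n k, μ.real {ω | chan t ω n k = true} = pbar n k
  chan_indep : ∀ t, iIndepFun (fun n ω => chan t ω n) μ
  /- Scheduling: one queue at most, queue `n` with probability `τ n S` in state `S`. -/
  grant_unique : ∀ t ω S n m, grant t ω S n = true → grant t ω S m = true → n = m
  grant_prob : ∀ t S n, μ.real {ω | grant t ω S n = true} = τ n S
  grant_indep : ∀ t, IndepFun (chan t) (grant t) μ
  /- A new head of queue `n` is of flow `k` with probability `α_{n,k}`. -/
  fresh_prob : ∀ t n k, μ.real {ω | fresh t ω n = k} = alpha lam n k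
  fresh_indep : ∀ t, IndepFun (fun ω => (chan t ω, grant t ω)) (fresh t) μ

namespace Network

variable {pbar lam : ∀ n, Fin (K n) → ℝ} {τ : Fin N → (Fin N → Bool) → ℝ}
  {Ω : Type*} [MeasurableSpace Ω] {μ : Measure Ω}

/-- Queue states when the head-of-line flows are `h`: queue `n` is ON iff the link of its
head-of-line packet is ON. -/
def stateOf (s : Network pbar lam τ μ) (t : ℕ) (ω : Ω) (h : ∀ n, Fin (K n)) : Fin N → Bool :=
  fun n => s.chan t ω n (h n)

/-- Whether the head of queue `n` is transmitted when the head-of-line flows are `h`. -/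
def serves (s : Network pbar lam τ μ) (t : ℕ) (ω : Ω) (h : ∀ n, Fin (K n)) (n : Fin N) : Bool :=
  s.stateOf t ω h n && s.grant t ω (s.stateOf t ω h) n

/-- `H_n(t)`: the head-of-line flows. -/
def hol (s : Network pbar lam τ μ) : ℕ → Ω → ∀ n, Fin (K n)
  | 0, ω => s.hol0 ω
  | t + 1, ω => fun n =>
      if s.serves t ω (s.hol t ω) n then s.fresh t ω n else s.hol t ω n

/-- `S_n(t)`: the queue states. -/
def queueState (s : Network pbar lam τ μ) (t : ℕ) (ω : Ω) : Fin N → Bool :=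
  s.stateOf t ω (s.hol t ω)

/-- `g_n(t)`: one if queue `n` is served in slot `t`, else zero. -/
def service (s : Network pbar lam τ μ) (t : ℕ) (ω : Ω) (n : Fin N) : ℝ :=
  onIndicator (s.queueState t ω n && s.grant t ω (s.queueState t ω) n)

/-- `Q_n(t)`: the queue sizes, `Q_n(t+1) = max [Q_n(t) - g_n(t), 0] + ∑_k λ_{n,k}(t)`. -/
def backlog (s : Network pbar lam τ μ) : ℕ → Ω → Fin N → ℝ
  | 0, ω => s.backlog0 ω
  | t + 1, ω => fun n =>
      max (s.backlog t ω n - s.service t ω n) 0 + ∑ k, s.arr t ω n k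

/-- All queues are (mean rate) stable: `E[Q_n(t)] / t → 0`. -/
def IsStable (s : Network pbar lam τ μ) : Prop :=
  ∀ n, (∀ t, Integrable (fun ω => s.backlog t ω n) μ) ∧
    Tendsto (fun t : ℕ => (∫ ω, s.backlog t ω n ∂μ) / t) atTop (𝓝 0)

/-- All queues are strongly stable: the time averages of `E[Q_n(t)]` are bounded. -/
def IsStronglyStable (s : Network pbar lam τ μ) : Prop :=
  ∀ n, (∀ t, Integrable (fun ω => s.backlog t ω n) μ) ∧
    ∃ B : ℝ, ∀ T : ℕ, 1 ≤ T →
      (∑ t ∈ Finset.range T, ∫ ω, s.backlog t ω n ∂μ) / T ≤ B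

end Network

/-- The stability region under the policy `τ`: the rate vectors for which the network, however
realized, is stable. -/
def stabilityRegion (pbar : ∀ n, Fin (K n) → ℝ) (τ : Fin N → (Fin N → Bool) → ℝ) :
    Set (∀ n, Fin (K n) → ℝ) :=
  {lam | IsTraffic lam ∧ IsRegular pbar lam τ ∧
    ∀ (Ω : Type) [MeasurableSpace Ω] (μ : Measure Ω) [IsProbabilityMeasure μ]
      (s : Network pbar lam τ μ), s.IsStable}

end FifoWireless

end

/-! The heads form a finite Markov chain that is reversible with respect to the product weights
λ_{n,h_n}/p̄_{n,h_n}: a head moves only when its link is ON, and the ON probability p̄ cancels the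
denominator (`steady_mul_holTransition`). In this steady state the queue states are independent with
laws ψ_m, so queue n has service rate r_n = `serviceRate`. The bound for flow k is α_{n,k} r_n, so
the constraints of queue n amount to the single inequality Λ_n ≤ r_n with Λ_n = ∑_k λ_{n,k}
(`le_rateBound_iff`).

The passage from steady state to time averages goes through the Poisson equation p_n(h) - r_n = u(h)
- (Pu)(h), where p_n(h) is the service probability given the heads. It makes the expected service in
T slots equal to r_n T up to a bounded error, with no convergence of the chain. It is solved by
duality when the stationary law is unique, and by a maximum principle when all links can be OFF and
every queue is sometimes served. A queue that is never served has r_n = 0 < Λ_n, and stability and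
the constraints fail together.

Necessity: E[Q_n(T)] ≥ (Λ_n - r_n)T - 2U with U a bound for |u| (`le_integral_backlog`).
Sufficiency: Q_n is at most its initial value plus two queues started empty, one fed by the arrivals
and served at a constant rate c, the other fed at rate c and served like queue n
(`le_lindley_add_lindley`). Each is treated by its own second-moment drift, so no joint law of
arrivals and services is needed; in the second, u supplies a corrector E[Q u(H)]. The choice c = r_n
gives E[Q_n(T)] = O(√T) even when Λ_n = r_n; a c strictly between Λ_n and r_n gives strong
stability. -/

namespace FifoWireless

/-! ### Product-form steady state and service rates. -/

/-- Probability of the joint state `S` when the head-of-line flows are `h`. -/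
noncomputable def stateProb {N : ℕ} {K : Fin N → ℕ} (pbar : ∀ n, Fin (K n) → ℝ)
    (h : ∀ n, Fin (K n)) (S : Fin N → Bool) : ℝ :=
  ∏ n, if S n then pbar n (h n) else 1 - pbar n (h n)

/-- Probability that queue `n` is served when the head-of-line flows are `h`. -/
noncomputable def serviceProb {N : ℕ} {K : Fin N → ℕ} (pbar : ∀ n, Fin (K n) → ℝ)
    (τ : Fin N → (Fin N → Bool) → ℝ) (n : Fin N) (h : ∀ n, Fin (K n)) : ℝ :=
  ∑ S : Fin N → Bool, stateProb pbar h S * (onIndicator (S n) * τ n S)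

/-- Long-run service rate of queue `n`. -/
noncomputable def serviceRate {N : ℕ} {K : Fin N → ℕ} (pbar lam : ∀ n, Fin (K n) → ℝ)
    (τ : Fin N → (Fin N → Bool) → ℝ) (n : Fin N) : ℝ :=
  ∑ S : Fin N → Bool, (∏ m, psi pbar lam m (S m)) * (onIndicator (S n) * τ n S)

/-- Mean of `u` after one slot of the head-of-line chain started at `h`. -/
noncomputable def meanNext {N : ℕ} {K : Fin N → ℕ} (pbar lam : ∀ n, Fin (K n) → ℝ)
    (τ : Fin N → (Fin N → Bool) → ℝ) (u : (∀ n, Fin (K n)) → ℝ) (h : ∀ n, Fin (K n)) : ℝ :=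
  ∑ S : Fin N → Bool, stateProb pbar h S *
    ((∑ n, onIndicator (S n) * τ n S * ∑ k, alpha lam n k * u (Function.update h n k)) +
      (1 - ∑ n, onIndicator (S n) * τ n S) * u h)

/-- The product-form steady state. -/
noncomputable def steady {N : ℕ} {K : Fin N → ℕ} (pbar lam : ∀ n, Fin (K n) → ℝ)
    (h : ∀ n, Fin (K n)) : ℝ :=
  ∏ n, lam n (h n) / pbar n (h n) / ∑ l, lam n l / pbar n l

section Algebra

variable {N : ℕ} {K : Fin N → ℕ} {pbar lam : ∀ n, Fin (K n) → ℝ}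
  {τ : Fin N → (Fin N → Bool) → ℝ}

lemma onIndicator_nonneg (b : Bool) : 0 ≤ onIndicator b := by
  cases b <;> simp [onIndicator]

lemma onIndicator_le_one (b : Bool) : onIndicator b ≤ 1 := by
  cases b <;> simp [onIndicator]

lemma sum_stateProb (pbar : ∀ n, Fin (K n) → ℝ) (h : ∀ n, Fin (K n)) :
    ∑ S, stateProb pbar h S = 1 := by
  unfold stateProb
  rw [← Fintype.prod_sum (fun n (b : Bool) => if b then pbar n (h n) else 1 - pbar n (h n))]
  simp

lemma stateProb_nonneg (hpbar : ∀ n k, 0 < pbar n k ∧ pbar n k ≤ 1) (h : ∀ n, Fin (K n))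
    (S : Fin N → Bool) : 0 ≤ stateProb pbar h S := by
  refine Finset.prod_nonneg fun n _ => ?_
  have := hpbar n (h n)
  split_ifs <;> linarith

lemma sum_alpha (hlam : IsTraffic lam) (n : Fin N) : ∑ k, alpha lam n k = 1 := by
  unfold alpha
  rw [← Finset.sum_div]
  exact div_self (hlam.2 n).ne'

lemma alpha_nonneg (hlam : IsTraffic lam) (n : Fin N) (k : Fin (K n)) : 0 ≤ alpha lam n k :=
  div_nonneg (hlam.1 n k) (hlam.2 n).le

lemma sum_onIndicator_mul_le_one (hτ : IsQueueStatePolicy τ) (S : Fin N → Bool) :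
    ∑ n, onIndicator (S n) * τ n S ≤ 1 := by
  refine le_trans (Finset.sum_le_sum fun n _ => ?_) (hτ.2 S)
  exact mul_le_of_le_one_left (hτ.1 n S) (onIndicator_le_one _)

lemma sum_update_eq (h : ∀ n, Fin (K n)) (n : Fin N) (f : Fin (K n) → ℝ)
    (u : (∀ n, Fin (K n)) → ℝ) :
    ∑ h' : ∀ n, Fin (K n), (if h' = Function.update h n (h' n) then f (h' n) else 0) * u h' =
      ∑ k, f k * u (Function.update h n k) := by
  simp_rw [ite_mul, zero_mul]
  rw [← Finset.sum_filter]
  symm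
  refine Finset.sum_bij (fun k _ => Function.update h n k) ?_ ?_ ?_ ?_
  · intro k _; simp
  · intro a _ b _ e; exact Function.update_injective h n e
  · intro h' hh'
    exact ⟨h' n, Finset.mem_univ _, (Finset.mem_filter.1 hh').2.symm⟩
  · intro k _; simp

/-- Identifies `meanNext` with the action of the transition matrix; `meanNext` is the form in which
the one-slot expectation arises from the random inputs. -/
lemma sum_holTransition_mul (u : (∀ n, Fin (K n)) → ℝ) (h : ∀ n, Fin (K n)) :
    ∑ h', holTransition pbar lam τ h h' * u h' = meanNext pbar lam τ u h := by
  unfold holTransition meanNext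
  simp_rw [Finset.sum_mul]
  rw [Finset.sum_comm]
  refine Finset.sum_congr rfl fun S _ => ?_
  simp_rw [mul_assoc]
  rw [← Finset.mul_sum]
  congr 1
  simp_rw [add_mul, Finset.sum_add_distrib, Finset.sum_mul]
  congr 1
  · rw [Finset.sum_comm]
    refine Finset.sum_congr rfl fun n _ => ?_
    simp_rw [mul_assoc]
    rw [← Finset.mul_sum, ← Finset.mul_sum, sum_update_eq]
  · simp_rw [mul_assoc]
    rw [← Finset.mul_sum]
    simp

lemma meanNext_const (hlam : IsTraffic lam) (c : ℝ) (h : ∀ n, Fin (K n)) :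
    meanNext pbar lam τ (fun _ => c) h = c := by
  unfold meanNext
  simp_rw [← Finset.sum_mul, sum_alpha hlam, one_mul, ← Finset.sum_mul, ← add_mul,
    add_sub_cancel, one_mul]
  rw [← Finset.sum_mul, sum_stateProb, one_mul]

lemma sum_holTransition (hlam : IsTraffic lam) (h : ∀ n, Fin (K n)) :
    ∑ h', holTransition pbar lam τ h h' = 1 := by
  have := sum_holTransition_mul (pbar := pbar) (lam := lam) (τ := τ) (fun _ => 1) h
  rw [meanNext_const hlam] at this
  simpa using this

lemma holTransition_nonneg (hpbar : ∀ n k, 0 < pbar n k ∧ pbar n k ≤ 1)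
    (hτ : IsQueueStatePolicy τ) (hlam : IsTraffic lam) (h h' : ∀ n, Fin (K n)) :
    0 ≤ holTransition pbar lam τ h h' := by
  refine Finset.sum_nonneg fun S _ => mul_nonneg (stateProb_nonneg hpbar h S) (add_nonneg ?_ ?_)
  · refine Finset.sum_nonneg fun n _ => mul_nonneg (mul_nonneg (onIndicator_nonneg _) (hτ.1 n S)) ?_
    split_ifs
    exacts [alpha_nonneg hlam _ _, le_rfl]
  · refine mul_nonneg (sub_nonneg.2 (sum_onIndicator_mul_le_one hτ S)) ?_
    split_ifs <;> norm_num

lemma sum_div_pbar_pos (hpbar : ∀ n k, 0 < pbar n k ∧ pbar n k ≤ 1) (hlam : IsTraffic lam)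
    (n : Fin N) : 0 < ∑ l, lam n l / pbar n l := by
  refine lt_of_lt_of_le (hlam.2 n) (Finset.sum_le_sum fun l _ => ?_)
  rw [le_div_iff₀ (hpbar n l).1]
  exact mul_le_of_le_one_right (hlam.1 n l) (hpbar n l).2

lemma steady_nonneg (hpbar : ∀ n k, 0 < pbar n k ∧ pbar n k ≤ 1) (hlam : IsTraffic lam)
    (h : ∀ n, Fin (K n)) : 0 ≤ steady pbar lam h :=
  Finset.prod_nonneg fun n _ => div_nonneg (div_nonneg (hlam.1 n _) (hpbar n _).1.le)
    (sum_div_pbar_pos hpbar hlam n).le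

lemma sum_steady (hpbar : ∀ n k, 0 < pbar n k ∧ pbar n k ≤ 1) (hlam : IsTraffic lam) :
    ∑ h, steady pbar lam h = 1 := by
  unfold steady
  rw [← Fintype.prod_sum (fun n k => lam n k / pbar n k / ∑ l, lam n l / pbar n l)]
  simp_rw [← Finset.sum_div]
  exact Finset.prod_eq_one fun n _ => div_self (sum_div_pbar_pos hpbar hlam n).ne'

lemma sum_weight_eq_psi (hpbar : ∀ n k, 0 < pbar n k ∧ pbar n k ≤ 1) (n : Fin N) (b : Bool) :
    ∑ k, lam n k / pbar n k / (∑ l, lam n l / pbar n l) *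
      (if b then pbar n k else 1 - pbar n k) = psi pbar lam n b := by
  unfold psi
  rw [Finset.sum_div]
  refine Finset.sum_congr rfl fun k _ => ?_
  have := (hpbar n k).1.ne'
  cases b
  · simp only [rho, Bool.false_eq_true, if_false]; ring
  · simp only [rho, if_true]; field_simp

/-- The joint state has product law in steady state. -/
lemma sum_steady_mul_stateProb (hpbar : ∀ n k, 0 < pbar n k ∧ pbar n k ≤ 1) (S : Fin N → Bool) :
    ∑ h, steady pbar lam h * stateProb pbar h S = ∏ m, psi pbar lam m (S m) := by
  unfold steady stateProb
  simp_rw [← Finset.prod_mul_distrib, ← sum_weight_eq_psi hpbar]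
  rw [Fintype.prod_sum]

lemma sum_steady_mul_serviceProb (hpbar : ∀ n k, 0 < pbar n k ∧ pbar n k ≤ 1) (n : Fin N) :
    ∑ h, steady pbar lam h * serviceProb pbar τ n h = serviceRate pbar lam τ n := by
  unfold serviceProb serviceRate
  simp_rw [← sum_steady_mul_stateProb hpbar, Finset.mul_sum, Finset.sum_mul]
  rw [Finset.sum_comm]
  simp_rw [mul_assoc]

/-- Since ψ_n(ON) = ∑ λ / ∑ (λ/p̄), the prefactor of the bound is α_{n,k} ψ_n(ON), which restores
the factor m = n missing from the product over the other queues. -/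
lemma rateBound_eq (hlam : IsTraffic lam) (n : Fin N) (k : Fin (K n)) :
    rateBound pbar lam τ n k = alpha lam n k * serviceRate pbar lam τ n := by
  unfold rateBound serviceRate alpha
  rw [Finset.mul_sum]
  refine Finset.sum_congr rfl fun S _ => ?_
  rw [← Finset.mul_prod_erase _ _ (Finset.mem_univ n)]
  have := (hlam.2 n).ne'
  cases hS : S n
  · simp [onIndicator]
  · simp only [psi, rho, onIndicator, if_true, mul_one, one_mul]
    field_simp

lemma le_rateBound_iff (hlam : IsTraffic lam) (n : Fin N) :
    (∀ k, lam n k ≤ rateBound pbar lam τ n k) ↔ ∑ k, lam n k ≤ serviceRate pbar lam τ n := by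
  simp_rw [rateBound_eq hlam]
  constructor
  · intro h
    have := Finset.sum_le_sum fun k (_ : k ∈ Finset.univ) => h k
    rwa [← Finset.sum_mul, sum_alpha hlam, one_mul] at this
  · intro h k
    have h1 : lam n k = alpha lam n k * ∑ k, lam n k :=
      (div_mul_cancel₀ _ (hlam.2 n).ne').symm
    rw [h1]
    exact mul_le_mul_of_nonneg_left h (alpha_nonneg hlam n k)

lemma sum_lt_serviceRate (hlam : IsTraffic lam) (n : Fin N)
    (h : ∀ k, 0 < lam n k → lam n k < rateBound pbar lam τ n k) :
    ∑ k, lam n k < serviceRate pbar lam τ n := by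
  obtain ⟨k, -, hk⟩ := Finset.exists_lt_of_sum_lt (s := Finset.univ) (f := fun _ => (0 : ℝ))
    (g := fun k => lam n k) (by simpa using hlam.2 n)
  have h2 := h k hk
  rw [rateBound_eq hlam] at h2
  have ha : 0 < alpha lam n k := div_pos hk (hlam.2 n)
  have h1 : lam n k = alpha lam n k * ∑ k, lam n k :=
    (div_mul_cancel₀ _ (hlam.2 n).ne').symm
  rw [h1] at h2
  exact lt_of_mul_lt_mul_left h2 ha.le

/-- Detailed balance. -/
lemma steady_mul_holTransition (hpbar : ∀ n k, 0 < pbar n k ∧ pbar n k ≤ 1)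
    (h h' : ∀ n, Fin (K n)) :
    steady pbar lam h * holTransition pbar lam τ h h' =
      steady pbar lam h' * holTransition pbar lam τ h' h := by
  by_cases hh : h = h'
  · rw [hh]
  have hh' : h' ≠ h := fun e => hh e.symm
  unfold holTransition steady
  -- Off the diagonal the term for an unchanged head vector vanishes; balance then holds separately
  -- for each joint state and each served queue.
  simp only [hh, hh', if_false, mul_zero, add_zero, Finset.mul_sum]
  refine Finset.sum_congr rfl fun S _ => Finset.sum_congr rfl fun n _ => ?_
  by_cases e : h' = Function.update h n (h' n)
  swap
  · have e' : ¬ h = Function.update h' n (h n) := by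
      intro e'
      apply e
      rw [e']; simp
    rw [if_neg e, if_neg e']; simp
  have e' : h = Function.update h' n (h n) := by
    rw [e]; simp
  rw [if_pos e, if_pos e']
  have hm : ∀ m ∈ Finset.univ.erase n, h' m = h m := by
    intro m hm
    rw [e, Function.update_of_ne (Finset.ne_of_mem_erase hm)]
  cases hS : S n
  · simp [onIndicator]
  -- With queue `n` ON, its weight λ/p̄ meets the factor p̄ and only λ remains. Multiplied by the α
  -- of the other head, this is symmetric in the two heads.
  have key : ∀ g : ∀ n, Fin (K n), (∏ m, lam m (g m) / pbar m (g m) / ∑ l, lam m l / pbar m l) *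
      (∏ m, if S m then pbar m (g m) else 1 - pbar m (g m)) =
      (lam n (g n) / ∑ l, lam n l / pbar n l) * ∏ m ∈ Finset.univ.erase n,
        (lam m (g m) / pbar m (g m) / ∑ l, lam m l / pbar m l) *
          (if S m then pbar m (g m) else 1 - pbar m (g m)) := by
    intro g
    rw [← Finset.prod_mul_distrib, ← Finset.mul_prod_erase _ _ (Finset.mem_univ n)]
    congr 1
    rw [hS, if_pos rfl]
    have := (hpbar n (g n)).1.ne'
    field_simp
  rw [← mul_assoc, ← mul_assoc, key h, ← mul_assoc, ← mul_assoc, key h']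
  have hprod : ∏ m ∈ Finset.univ.erase n, (lam m (h m) / pbar m (h m) / ∑ l, lam m l / pbar m l) *
      (if S m then pbar m (h m) else 1 - pbar m (h m)) =
      ∏ m ∈ Finset.univ.erase n, (lam m (h' m) / pbar m (h' m) / ∑ l, lam m l / pbar m l) *
      (if S m then pbar m (h' m) else 1 - pbar m (h' m)) :=
    Finset.prod_congr rfl fun m hm' => by rw [hm m hm']
  rw [hprod]
  unfold alpha
  ring

lemma steady_isSteadyState (hpbar : ∀ n k, 0 < pbar n k ∧ pbar n k ≤ 1) (hlam : IsTraffic lam)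
    (τ : Fin N → (Fin N → Bool) → ℝ) : IsSteadyState pbar lam τ (steady pbar lam) := by
  refine ⟨steady_nonneg hpbar hlam, sum_steady hpbar hlam, fun h' => ?_⟩
  simp_rw [fun h => steady_mul_holTransition (lam := lam) (τ := τ) hpbar h h']
  rw [← Finset.mul_sum, sum_holTransition hlam, mul_one]

end Algebra

/-! ### The Poisson equation of the head-of-line chain. -/

section Poisson

variable {N : ℕ} {K : Fin N → ℕ} {pbar lam : ∀ n, Fin (K n) → ℝ}
  {τ : Fin N → (Fin N → Bool) → ℝ}

/-- The absolute value of an invariant signed measure of a stochastic matrix is invariant. -/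
lemma abs_invariant {X : Type*} [Fintype X] {P : X → X → ℝ} (hP : ∀ x y, 0 ≤ P x y)
    (hP1 : ∀ x, ∑ y, P x y = 1) {ν : X → ℝ} (hν : ∀ y, ∑ x, ν x * P x y = ν y) (y : X) :
    ∑ x, |ν x| * P x y = |ν y| := by
  have hle : ∀ y ∈ Finset.univ, |ν y| ≤ ∑ x, |ν x| * P x y := by
    intro y _
    rw [← hν y]
    refine (Finset.abs_sum_le_sum_abs _ _).trans (Finset.sum_le_sum fun x _ => ?_)
    rw [abs_mul, abs_of_nonneg (hP x y)]
  -- Rows sum to one, so both sides of `hle` have the same total, which forces equality at every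
  -- point.
  have hsum : ∑ y, |ν y| = ∑ y, ∑ x, |ν x| * P x y := by
    rw [Finset.sum_comm]
    simp_rw [← Finset.mul_sum, hP1, mul_one]
  exact ((Finset.sum_eq_sum_iff_of_le hle).1 hsum y (Finset.mem_univ y)).symm

lemma invariant_eq_smul_steady (hpbar : ∀ n k, 0 < pbar n k ∧ pbar n k ≤ 1)
    (hlam : IsTraffic lam)
    (huniq : ∀ w w', IsSteadyState pbar lam τ w → IsSteadyState pbar lam τ w' → w = w')
    {ν : (∀ n, Fin (K n)) → ℝ} (hν0 : ∀ h, 0 ≤ ν h)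
    (hν : ∀ h', ∑ h, ν h * holTransition pbar lam τ h h' = ν h') (h : ∀ n, Fin (K n)) :
    ν h = (∑ g, ν g) * steady pbar lam h := by
  rcases (Finset.sum_nonneg fun g (_ : g ∈ Finset.univ) => hν0 g).eq_or_lt with h0 | hpos
  · rw [← h0, zero_mul]
    exact (Finset.sum_eq_zero_iff_of_nonneg fun g _ => hν0 g).1 h0.symm h (Finset.mem_univ h)
  · have hs : IsSteadyState pbar lam τ fun h => ν h / ∑ g, ν g := by
      refine ⟨fun h => div_nonneg (hν0 h) hpos.le, ?_, fun h' => ?_⟩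
      · rw [← Finset.sum_div, div_self hpos.ne']
      · simp_rw [div_mul_eq_mul_div]
        rw [← Finset.sum_div, hν]
    rw [huniq _ _ (steady_isSteadyState hpbar hlam τ) hs]
    exact (mul_div_cancel₀ _ hpos.ne').symm

/-- The operator `u ↦ u - P u` of the head-of-line chain. -/
noncomputable def poissonOp (pbar lam : ∀ n, Fin (K n) → ℝ) (τ : Fin N → (Fin N → Bool) → ℝ) :
    ((∀ n, Fin (K n)) → ℝ) →ₗ[ℝ] ((∀ n, Fin (K n)) → ℝ) :=
  LinearMap.id - (Matrix.of (holTransition pbar lam τ)).mulVecLin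

lemma poissonOp_apply (u : (∀ n, Fin (K n)) → ℝ) (h : ∀ n, Fin (K n)) :
    poissonOp pbar lam τ u h = u h - meanNext pbar lam τ u h := by
  rw [← sum_holTransition_mul]
  simp [poissonOp, Matrix.mulVec, dotProduct]

lemma sum_steady_mul_poissonOp (hpbar : ∀ n k, 0 < pbar n k ∧ pbar n k ≤ 1)
    (hlam : IsTraffic lam) (u : (∀ n, Fin (K n)) → ℝ) :
    ∑ h, steady pbar lam h * poissonOp pbar lam τ u h = 0 := by
  simp_rw [poissonOp_apply, mul_sub, Finset.sum_sub_distrib, ← sum_holTransition_mul,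
    Finset.mul_sum]
  rw [Finset.sum_comm (γ := ∀ n, Fin (K n))]
  simp_rw [← mul_assoc, ← Finset.sum_mul, (steady_isSteadyState hpbar hlam τ).2.2]
  exact sub_self _

/-- Fredholm alternative: a functional that kills the range is an invariant signed measure, hence a
multiple of the steady state, and so it kills every `f` of steady mean zero. -/
lemma mem_range_poissonOp_of_unique (hpbar : ∀ n k, 0 < pbar n k ∧ pbar n k ≤ 1)
    (hτ : IsQueueStatePolicy τ) (hlam : IsTraffic lam)
    (huniq : ∀ w w', IsSteadyState pbar lam τ w → IsSteadyState pbar lam τ w' → w = w')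
    {f : (∀ n, Fin (K n)) → ℝ} (hf : ∑ h, steady pbar lam h * f h = 0) :
    f ∈ LinearMap.range (poissonOp pbar lam τ) := by
  by_contra hmem
  obtain ⟨φ, hφf, hφ⟩ := Submodule.exists_le_ker_of_notMem hmem
  set ν : (∀ n, Fin (K n)) → ℝ := fun h => φ (Pi.single h 1) with hνdef
  have hφν : ∀ u, φ u = ∑ h, u h * ν h := by
    intro u
    rw [LinearMap.pi_apply_eq_sum_univ φ u]
    refine Finset.sum_congr rfl fun h _ => ?_
    rw [smul_eq_mul, hνdef]
    congr 2
    ext j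
    simp [Pi.single_apply, eq_comm]
  -- Invariance is the vanishing of `φ` on the images of point masses.
  have hν : ∀ h', ∑ h, ν h * holTransition pbar lam τ h h' = ν h' := by
    intro h'
    have h1 : φ (poissonOp pbar lam τ (Pi.single h' 1)) = 0 :=
      hφ (LinearMap.mem_range_self _ _)
    rw [hφν] at h1
    simp_rw [poissonOp_apply, ← sum_holTransition_mul, sub_mul, Finset.sum_sub_distrib] at h1
    simp [Pi.single_apply] at h1
    simp_rw [mul_comm (ν _)]
    linarith
  have habs := abs_invariant (holTransition_nonneg hpbar hτ hlam) (sum_holTransition hlam) hν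
  have h1 := invariant_eq_smul_steady hpbar hlam huniq (fun h => abs_nonneg (ν h)) habs
  -- Uniqueness concerns nonnegative measures only; ν is the difference of the nonnegative invariant
  -- measures |ν| + ν and |ν|.
  have h2 := invariant_eq_smul_steady hpbar hlam huniq (ν := fun h => |ν h| + ν h)
    (fun h => by linarith [neg_abs_le (ν h)])
    (fun h' => by simp_rw [add_mul, Finset.sum_add_distrib, habs, hν])
  apply hφf
  rw [hφν]
  have h3 : ∀ h, ν h = ((∑ g, (|ν g| + ν g)) - ∑ g, |ν g|) * steady pbar lam h := by
    intro h
    rw [sub_mul, ← h1 h, ← h2 h]; ring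
  rw [Finset.sum_congr rfl fun h _ => show f h * ν h =
    ((∑ g, (|ν g| + ν g)) - ∑ g, |ν g|) * (steady pbar lam h * f h) by
      nth_rewrite 1 [h3 h]; ring, ← Finset.mul_sum, hf, mul_zero]

/-- Weights of the averages in `meanNext`: if `M - u` has mean zero and is nonnegative, it
vanishes at each point that is reached with positive probability. -/
lemma eq_of_meanNext_eq (hpbar : ∀ n k, 0 < pbar n k ∧ pbar n k ≤ 1)
    (hτ : IsQueueStatePolicy τ) (hlam : IsTraffic lam) {u : (∀ n, Fin (K n)) → ℝ}
    (h0 : ∀ h, 0 ≤ u h) {h : ∀ n, Fin (K n)} (hm : meanNext pbar lam τ u h = 0)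
    {S : Fin N → Bool} (hS : 0 < stateProb pbar h S) {n : Fin N}
    (hn : 0 < onIndicator (S n) * τ n S) {k : Fin (K n)} (hk : 0 < lam n k) :
    u (Function.update h n k) = 0 := by
  have hA : ∀ S n, 0 ≤ onIndicator (S n) * τ n S * ∑ k, alpha lam n k * u (Function.update h n k) :=
    fun S n => mul_nonneg (mul_nonneg (onIndicator_nonneg _) (hτ.1 n S))
      (Finset.sum_nonneg fun k _ => mul_nonneg (alpha_nonneg hlam n k) (h0 _))
  have hB : ∀ S : Fin N → Bool, 0 ≤ (1 - ∑ n, onIndicator (S n) * τ n S) * u h :=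
    fun S => mul_nonneg (sub_nonneg.2 (sum_onIndicator_mul_le_one hτ S)) (h0 h)
  have h1 := (Finset.sum_eq_zero_iff_of_nonneg fun S _ => mul_nonneg (stateProb_nonneg hpbar h S)
    (add_nonneg (Finset.sum_nonneg fun n _ => hA S n) (hB S))).1 hm S (Finset.mem_univ S)
  have h2 := (mul_eq_zero.1 h1).resolve_left hS.ne'
  have h3 := (add_eq_zero_iff_of_nonneg (Finset.sum_nonneg fun n _ => hA S n) (hB S)).1 h2
  have h4 := (Finset.sum_eq_zero_iff_of_nonneg fun n _ => hA S n).1 h3.1 n (Finset.mem_univ n)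
  have h5 := (mul_eq_zero.1 h4).resolve_left hn.ne'
  have h6 := (Finset.sum_eq_zero_iff_of_nonneg fun k _ =>
    mul_nonneg (alpha_nonneg hlam n k) (h0 _)).1 h5 k (Finset.mem_univ k)
  exact (mul_eq_zero.1 h6).resolve_left (div_pos hk (hlam.2 n)).ne'

lemma exists_pos (hlam : IsTraffic lam) : ∃ s : ∀ n, Fin (K n), ∀ n, 0 < lam n (s n) := by
  have : ∀ n, ∃ k, 0 < lam n k := fun n => by
    obtain ⟨k, -, hk⟩ := Finset.exists_lt_of_sum_lt (s := Finset.univ) (f := fun _ => (0 : ℝ))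
      (g := fun k => lam n k) (by simpa using hlam.2 n)
    exact ⟨k, hk⟩
  exact ⟨fun n => (this n).choose, fun n => (this n).choose_spec⟩

/-- A zero of a nonnegative harmonic function spreads along possible transitions. From `x` the heads
are replaced by those of `s` one queue at a time: every joint state has positive probability because
0 < p̄ < 1, and some joint state serves the queue in question. -/
lemma apply_eq_zero_of_harmonic (hpbar : ∀ n k, 0 < pbar n k ∧ pbar n k ≤ 1)
    (hτ : IsQueueStatePolicy τ) (hlam : IsTraffic lam) (hlt : ∀ n k, pbar n k < 1)
    (halive : ∀ n, ∃ S : Fin N → Bool, 0 < onIndicator (S n) * τ n S)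
    {u : (∀ n, Fin (K n)) → ℝ} (h0 : ∀ h, 0 ≤ u h) (hm : ∀ h, meanNext pbar lam τ u h = u h)
    {s : ∀ n, Fin (K n)} (hs : ∀ n, 0 < lam n (s n)) {x : ∀ n, Fin (K n)} (hx : u x = 0) :
    u s = 0 := by
  have key : ∀ A : Finset (Fin N), u (fun n => if n ∈ A then s n else x n) = 0 := by
    intro A
    induction A using Finset.induction_on with
    | empty => simpa using hx
    | insert n A _ ih =>
      obtain ⟨S, hS⟩ := halive n
      have hpos : 0 < stateProb pbar (fun n => if n ∈ A then s n else x n) S := by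
        refine Finset.prod_pos fun m _ => ?_
        split_ifs
        exacts [(hpbar m _).1, sub_pos.2 (hlt m _)]
      have := eq_of_meanNext_eq hpbar hτ hlam h0 ((hm _).trans ih) hpos hS (hs n)
      rw [← this]
      congr 1
      ext m
      by_cases hmn : m = n
      · subst hmn; simp
      · simp [hmn]
  simpa using key Finset.univ

lemma meanNext_add (hlam : IsTraffic lam) (u : (∀ n, Fin (K n)) → ℝ) (a c : ℝ)
    (h : ∀ n, Fin (K n)) :
    meanNext pbar lam τ (fun g => a * u g + c) h = a * meanNext pbar lam τ u h + c := by
  rw [← sum_holTransition_mul, ← sum_holTransition_mul, Finset.mul_sum]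
  simp_rw [mul_add, Finset.sum_add_distrib]
  rw [← Finset.sum_mul, sum_holTransition hlam, one_mul]
  congr 1
  exact Finset.sum_congr rfl fun _ _ => by ring

/-- Maximum principle: applied to max u - u and to u - min u, the propagation of zeros shows that
both extremes are attained at the same point `s`. -/
lemma harmonic_const (hpbar : ∀ n k, 0 < pbar n k ∧ pbar n k ≤ 1)
    (hτ : IsQueueStatePolicy τ) (hlam : IsTraffic lam) (hlt : ∀ n k, pbar n k < 1)
    (halive : ∀ n, ∃ S : Fin N → Bool, 0 < onIndicator (S n) * τ n S)
    {u : (∀ n, Fin (K n)) → ℝ} (hm : ∀ h, meanNext pbar lam τ u h = u h) :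
    ∃ c, ∀ h, u h = c := by
  obtain ⟨s, hs⟩ := exists_pos hlam
  have : Nonempty (∀ n, Fin (K n)) := ⟨s⟩
  obtain ⟨x, hx⟩ := Finite.exists_max u
  obtain ⟨y, hy⟩ := Finite.exists_min u
  have h1 := apply_eq_zero_of_harmonic hpbar hτ hlam hlt halive
    (u := fun h => (-1) * u h + u x) (fun h => by linarith [hx h])
    (fun h => by rw [meanNext_add hlam, hm]) hs (x := x) (by ring)
  have h2 := apply_eq_zero_of_harmonic hpbar hτ hlam hlt halive
    (u := fun h => 1 * u h + (- u y)) (fun h => by linarith [hy h])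
    (fun h => by rw [meanNext_add hlam, hm]) hs (x := y) (by ring)
  exact ⟨u s, fun h => le_antisymm (by linarith [hx h]) (by linarith [hy h])⟩

/-- The kernel is at most the constants, so the range has codimension at most one. The steady mean
vanishes on the range but not on nonzero constants, so the two span everything, and the constant
component of `f` is its steady mean. -/
lemma mem_range_poissonOp_of_alive (hpbar : ∀ n k, 0 < pbar n k ∧ pbar n k ≤ 1)
    (hτ : IsQueueStatePolicy τ) (hlam : IsTraffic lam) (hlt : ∀ n k, pbar n k < 1)
    (halive : ∀ n, ∃ S : Fin N → Bool, 0 < onIndicator (S n) * τ n S)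
    {f : (∀ n, Fin (K n)) → ℝ} (hf : ∑ h, steady pbar lam h * f h = 0) :
    f ∈ LinearMap.range (poissonOp pbar lam τ) := by
  set one : (∀ n, Fin (K n)) → ℝ := fun _ => 1 with hone
  have hker : LinearMap.ker (poissonOp pbar lam τ) ≤ Submodule.span ℝ {one} := by
    intro u hu
    obtain ⟨c, hc⟩ := harmonic_const hpbar hτ hlam hlt halive (u := u) fun h => by
      have := congrFun (LinearMap.mem_ker.1 hu) h
      rw [poissonOp_apply] at this
      simp only [Pi.zero_apply] at this
      linarith
    exact Submodule.mem_span_singleton.2 ⟨c, by ext h; simp [hone, hc]⟩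
  have hdisj : Disjoint (LinearMap.range (poissonOp pbar lam τ)) (Submodule.span ℝ {one}) := by
    rw [Submodule.disjoint_def]
    rintro _ ⟨u, rfl⟩ h2
    obtain ⟨c, hc⟩ := Submodule.mem_span_singleton.1 h2
    have h3 := sum_steady_mul_poissonOp (τ := τ) hpbar hlam u
    rw [← hc] at h3
    simp only [hone, Pi.smul_apply, smul_eq_mul, mul_one, ← Finset.sum_mul,
      sum_steady hpbar hlam, one_mul] at h3
    rw [← hc, h3, zero_smul]
  have htop : LinearMap.range (poissonOp pbar lam τ) ⊔ Submodule.span ℝ {one} = ⊤ := by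
    apply Submodule.eq_top_of_finrank_eq
    refine le_antisymm (Submodule.finrank_le _) ?_
    have e1 := Submodule.finrank_sup_add_finrank_inf_eq
      (LinearMap.range (poissonOp pbar lam τ)) (Submodule.span ℝ {one})
    rw [hdisj.eq_bot, finrank_bot, add_zero] at e1
    rw [e1, ← LinearMap.finrank_range_add_finrank_ker (poissonOp pbar lam τ)]
    exact Nat.add_le_add_left (Submodule.finrank_mono hker) _
  obtain ⟨v, ⟨u, rfl⟩, w, hw, hvw⟩ := Submodule.mem_sup.1 (htop ▸ Submodule.mem_top : f ∈ _)
  obtain ⟨c, rfl⟩ := Submodule.mem_span_singleton.1 hw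
  have hc : c = 0 := by
    rw [← hvw] at hf
    simp only [Pi.add_apply, mul_add, Finset.sum_add_distrib,
      sum_steady_mul_poissonOp (τ := τ) hpbar hlam u, hone, Pi.smul_apply, smul_eq_mul, mul_one,
      ← Finset.sum_mul, sum_steady hpbar hlam, one_mul, zero_add] at hf
    exact hf
  exact ⟨u, by rw [← hvw, hc, zero_smul, add_zero]⟩

/-- Either the Poisson equation of each service process is solvable, or some queue is never
served. -/
lemma exists_poisson_or_dead (hpbar : ∀ n k, 0 < pbar n k ∧ pbar n k ≤ 1)
    (hτ : IsQueueStatePolicy τ) (hlam : IsTraffic lam) (hreg : IsRegular pbar lam τ) :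
    (∀ n, ∃ u, ∀ h, serviceProb pbar τ n h - serviceRate pbar lam τ n =
        u h - meanNext pbar lam τ u h) ∨
      ∃ n, ∀ S : Fin N → Bool, onIndicator (S n) * τ n S = 0 := by
  have hf : ∀ n, ∑ h, steady pbar lam h *
      (serviceProb pbar τ n h - serviceRate pbar lam τ n) = 0 := by
    intro n
    simp_rw [mul_sub, Finset.sum_sub_distrib]
    rw [sum_steady_mul_serviceProb hpbar, ← Finset.sum_mul, sum_steady hpbar hlam, one_mul,
      sub_self]
  have conv : (∀ n, (fun h => serviceProb pbar τ n h - serviceRate pbar lam τ n) ∈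
      LinearMap.range (poissonOp pbar lam τ)) → ∀ n, ∃ u, ∀ h,
        serviceProb pbar τ n h - serviceRate pbar lam τ n = u h - meanNext pbar lam τ u h := by
    intro H n
    obtain ⟨u, hu⟩ := H n
    exact ⟨u, fun h => by rw [← poissonOp_apply, hu]⟩
  rcases hreg with hlt | huniq
  -- A queue that is never served keeps its head forever, so the chain may have several stationary
  -- laws; this case is set apart.
  · by_cases halive : ∀ n, ∃ S : Fin N → Bool, 0 < onIndicator (S n) * τ n S
    · exact Or.inl (conv fun n => mem_range_poissonOp_of_alive hpbar hτ hlam hlt halive (hf n))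
    · right
      push Not at halive
      obtain ⟨n, hn⟩ := halive
      exact ⟨n, fun S => le_antisymm (hn S) (mul_nonneg (onIndicator_nonneg _) (hτ.1 n S))⟩
  · exact Or.inl (conv fun n => mem_range_poissonOp_of_unique hpbar hτ hlam huniq (hf n))

end Poisson

/-! ### Independence of the present state from the present input. -/

section Independence

/-- The law of (f, g, k) is a triple product; the proof reassociates it. -/
lemma indepFun_prodMk_left_of_prodMk_right {Ω A B C : Type*} [MeasurableSpace Ω]
    [MeasurableSpace A] [MeasurableSpace B] [MeasurableSpace C] {μ : Measure Ω}
    [IsProbabilityMeasure μ] {f : Ω → A} {g : Ω → B} {k : Ω → C} (hf : Measurable f)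
    (hg : Measurable g) (hk : Measurable k) (h1 : IndepFun f (fun ω => (g ω, k ω)) μ)
    (h2 : IndepFun g k μ) : IndepFun (fun ω => (f ω, g ω)) k μ := by
  have hfg : IndepFun f g μ := h1.comp measurable_id measurable_fst
  have e1 := h1.map_prod_eq_prod_map_map hf.aemeasurable (hg.prodMk hk).aemeasurable
  have e2 := h2.map_prod_eq_prod_map_map hg.aemeasurable hk.aemeasurable
  have e3 := hfg.map_prod_eq_prod_map_map hf.aemeasurable hg.aemeasurable
  have := Measure.isProbabilityMeasure_map (μ := μ) hf.aemeasurable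
  have := Measure.isProbabilityMeasure_map (μ := μ) hg.aemeasurable
  have := Measure.isProbabilityMeasure_map (μ := μ) hk.aemeasurable
  rw [indepFun_iff_map_prod_eq_prod_map_map (hf.prodMk hg).aemeasurable hk.aemeasurable, e3]
  rw [e2] at e1
  apply MeasurableEquiv.prodAssoc.map_measurableEquiv_injective
  rw [Measure.prodAssoc_prod, ← e1,
    Measure.map_map (MeasurableEquiv.measurable _) ((hf.prodMk hg).prodMk hk)]
  rfl

lemma iIndepFun.indepFun_tail {Ω X : Type*} [MeasurableSpace Ω] [MeasurableSpace X]
    {μ : Measure Ω} {x : ℕ → Ω → X} (hx : ∀ t, Measurable (x t)) (hi : iIndepFun x μ) (t : ℕ) :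
    IndepFun (x t) (fun ω s => x (t + 1 + s) ω) μ := by
  have h := indep_iSup_of_disjoint (m := fun t => MeasurableSpace.comap (x t) inferInstance)
    (fun t => (hx t).comap_le) hi (S := {t}) (T := Set.Ioi t) (by simp)
  refine indep_of_indep_of_le_left (indep_of_indep_of_le_right h ?_) ?_
  · rw [MeasurableSpace.pi, MeasurableSpace.comap_iSup]
    refine iSup_le fun s => ?_
    rw [MeasurableSpace.comap_comp]
    exact le_iSup₂_of_le (t + 1 + s) (by simp; omega) le_rfl
  · exact le_iSup₂_of_le t (by simp) le_rfl

/-- A recursion driven by independent inputs is independent of the present input. -/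
lemma indepFun_of_recursion {Ω X Z : Type*} [MeasurableSpace Ω] [MeasurableSpace X]
    [MeasurableSpace Z] {μ : Measure Ω} [IsProbabilityMeasure μ] {x : ℕ → Ω → X} {z : ℕ → Ω → Z}
    (hx : ∀ t, Measurable (x t)) (hz : ∀ t, Measurable (z t)) (hi : iIndepFun x μ)
    (h0 : IndepFun (z 0) (fun ω t => x t ω) μ) {F : Z × X → Z} (hF : Measurable F)
    (hrec : ∀ t ω, z (t + 1) ω = F (z t ω, x t ω)) (t : ℕ) : IndepFun (z t) (x t) μ := by
  -- The induction needs independence from the whole future of the input, not only from its present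
  -- value.
  have key : ∀ t, IndepFun (z t) (fun ω s => x (t + s) ω) μ := by
    intro t
    induction t with
    | zero => simpa using h0
    | succ t ih =>
      have htail : Measurable fun ω s => x (t + 1 + s) ω := measurable_pi_iff.2 fun s => hx _
      have h1 : IndepFun (z t) (fun ω => (x t ω, fun s => x (t + 1 + s) ω)) μ := by
        have hm : Measurable fun v : ℕ → X => (v 0, fun s => v (1 + s)) :=
          (measurable_pi_apply 0).prodMk (measurable_pi_iff.2 fun s => measurable_pi_apply _)
        have := ih.comp measurable_id hm
        simpa [Function.comp_def, add_assoc] using this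
      have h2 := indepFun_prodMk_left_of_prodMk_right (hz t) (hx t) htail h1
        (iIndepFun.indepFun_tail hx hi t)
      have h3 := h2.comp hF measurable_id
      have h4 : z (t + 1) = fun ω => F (z t ω, x t ω) := funext (hrec t)
      rw [h4]
      exact h3
  exact (key t).comp measurable_id (measurable_pi_apply 0)

/-- An input that is independent of the state may be averaged out. -/
lemma integral_mul_apply_of_indepFun {Ω X Z H : Type*} [MeasurableSpace Ω] [MeasurableSpace X]
    [MeasurableSpace Z] [Fintype H] [MeasurableSpace H] [DiscreteMeasurableSpace H]
    {μ : Measure Ω} [IsProbabilityMeasure μ] {x : Ω → X} {z : Ω → Z} (hz : Measurable z)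
    (hi : IndepFun z x μ) {h : Z → H} (hh : Measurable h) {G : Z → ℝ}
    (hG : Measurable G) (hGi : Integrable (fun ω => G (z ω)) μ) {F : H → X → ℝ}
    (hF : ∀ a, Measurable (F a)) (hFi : ∀ a, Integrable (fun ω => F a (x ω)) μ) :
    Integrable (fun ω => G (z ω) * F (h (z ω)) (x ω)) μ ∧
    ∫ ω, G (z ω) * F (h (z ω)) (x ω) ∂μ =
      ∫ ω, G (z ω) * ∫ ω', F (h (z ω)) (x ω') ∂μ ∂μ := by
  classical
  have hset : ∀ a, MeasurableSet (h ⁻¹' {a}) := fun a => hh (MeasurableSet.of_discrete)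
  have hGm : ∀ a, Measurable ((h ⁻¹' {a}).indicator G) := fun a => hG.indicator (hset a)
  have hGint : ∀ a, Integrable (fun ω => (h ⁻¹' {a}).indicator G (z ω)) μ := by
    intro a
    exact hGi.indicator (s := z ⁻¹' (h ⁻¹' {a})) (hz (hset a))
  -- Splitting according to the finitely many values of `h (z ω)` makes each term a product of a
  -- function of `z` and a function of `x`.
  have hexp : ∀ (c : H → ℝ) (ω : Ω), G (z ω) * c (h (z ω)) =
      ∑ a, (h ⁻¹' {a}).indicator G (z ω) * c a := by
    intro c ω
    rw [Finset.sum_eq_single (h (z ω))]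
    · simp [Set.indicator]
    · intro b _ hb
      simp [Set.indicator, hb.symm]
    · simp
  have hind : ∀ a, IndepFun (fun ω => (h ⁻¹' {a}).indicator G (z ω)) (fun ω => F a (x ω)) μ :=
    fun a => hi.comp (hGm a) (hF a)
  have hint : ∀ a, Integrable (fun ω => (h ⁻¹' {a}).indicator G (z ω) * F a (x ω)) μ :=
    fun a => (hind a).integrable_mul (hGint a) (hFi a)
  have e1 : ∀ ω, G (z ω) * F (h (z ω)) (x ω) =
      ∑ a, (h ⁻¹' {a}).indicator G (z ω) * F a (x ω) := fun ω => hexp (fun a => F a (x ω)) ω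
  have e2 : ∀ ω, G (z ω) * ∫ ω', F (h (z ω)) (x ω') ∂μ =
      ∑ a, (h ⁻¹' {a}).indicator G (z ω) * ∫ ω', F a (x ω') ∂μ :=
    fun ω => hexp (fun a => ∫ ω', F a (x ω') ∂μ) ω
  constructor
  · simp_rw [e1]
    exact integrable_finsetSum _ fun a _ => hint a
  · simp_rw [e1, e2]
    rw [integral_finsetSum _ fun a _ => hint a,
      integral_finsetSum _ fun a _ => (hGint a).mul_const _]
    refine Finset.sum_congr rfl fun a _ => ?_
    rw [integral_mul_const, (hind a).integral_fun_mul_eq_mul_integral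
      (hGint a).aestronglyMeasurable (hFi a).aestronglyMeasurable]

end Independence

/-! ### One slot of the dynamics and its expectations. -/

/-- What drives the heads in one slot: link states, scheduling decisions, new heads. -/
abbrev Drive {N : ℕ} (K : Fin N → ℕ) : Type :=
  (∀ n, Fin (K n) → Bool) × ((Fin N → Bool) → Fin N → Bool) × (∀ n, Fin (K n))

/-- The joint queue state when the head-of-line flows are `h`. -/
def driveState {N : ℕ} {K : Fin N → ℕ} (h : ∀ n, Fin (K n)) (d : Drive K) : Fin N → Bool :=
  fun n => d.1 n (h n)

/-- Whether queue `n` is served when the head-of-line flows are `h`. -/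
def driveServes {N : ℕ} {K : Fin N → ℕ} (h : ∀ n, Fin (K n)) (d : Drive K) (n : Fin N) : Bool :=
  driveState h d n && d.2.1 (driveState h d) n

/-- The head-of-line flows after one slot that starts with `h`. -/
def driveNext {N : ℕ} {K : Fin N → ℕ} (h : ∀ n, Fin (K n)) (d : Drive K) : ∀ n, Fin (K n) :=
  fun n => if driveServes h d n then d.2.2 n else h n

section DriveAlgebra

variable {N : ℕ} {K : Fin N → ℕ}

lemma onIndicator_and (a b : Bool) : onIndicator (a && b) = onIndicator a * onIndicator b := by
  cases a <;> cases b <;> simp [onIndicator]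

lemma sum_onIndicator_decide_mul {X : Type*} [Fintype X] [DecidableEq X] (x : X) (F : X → ℝ) :
    ∑ y, onIndicator (decide (x = y)) * F y = F x := by
  simp [onIndicator]

/-- At most one queue is served, so at most one increment in the sum is nonzero. -/
lemma driveNext_eq {h : ∀ n, Fin (K n)} {d : Drive K}
    (hd : ∀ S n m, d.2.1 S n = true → d.2.1 S m = true → n = m)
    (u : (∀ n, Fin (K n)) → ℝ) :
    u (driveNext h d) = (∑ n, onIndicator (driveServes h d n) *
      (u (Function.update h n (d.2.2 n)) - u h)) + u h := by
  by_cases hs : ∃ n, driveServes h d n = true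
  · obtain ⟨n, hn⟩ := hs
    have hne : ∀ m, m ≠ n → driveServes h d m = false := by
      intro m hm
      by_contra hc
      rw [Bool.not_eq_false] at hc
      unfold driveServes at hc hn
      rw [Bool.and_eq_true] at hc hn
      exact hm (hd _ _ _ hc.2 hn.2)
    rw [Finset.sum_eq_single n]
    · have : driveNext h d = Function.update h n (d.2.2 n) := by
        ext m
        by_cases hm : m = n
        · subst hm; simp [driveNext, hn]
        · simp [driveNext, hne m hm, hm]
      rw [this, hn]
      simp [onIndicator]
    · intro m _ hm
      simp [hne m hm, onIndicator]
    · simp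
  · push Not at hs
    have h1 : ∀ n, driveServes h d n = false := fun n => by simpa using hs n
    have : driveNext h d = h := by
      ext m
      simp [driveNext, h1]
    rw [this]
    simp [h1, onIndicator]

/-- The decision is read at the random joint state; fixing that state `S` first separates links from
decisions, which are independent. -/
lemma onIndicator_driveServes (h : ∀ n, Fin (K n)) (d : Drive K) (n : Fin N) :
    onIndicator (driveServes h d n) = ∑ S, onIndicator (decide (driveState h d = S)) *
      (onIndicator (S n) * onIndicator (d.2.1 S n)) := by
  rw [sum_onIndicator_decide_mul, driveServes, onIndicator_and]

end DriveAlgebra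

lemma integral_onIndicator {Ω : Type*} [MeasurableSpace Ω] {μ : Measure Ω} {b : Ω → Bool}
    (hb : Measurable b) : ∫ ω, onIndicator (b ω) ∂μ = μ.real {ω | b ω = true} := by
  have hs : MeasurableSet {ω | b ω = true} := hb (measurableSet_singleton true)
  rw [← integral_indicator_one hs]
  refine integral_congr_ae (Eventually.of_forall fun ω => ?_)
  by_cases h : b ω = true <;> simp [onIndicator, h]

namespace Network

variable {N : ℕ} {K : Fin N → ℕ} {pbar lam : ∀ n, Fin (K n) → ℝ}
  {τ : Fin N → (Fin N → Bool) → ℝ} {Ω : Type*} [MeasurableSpace Ω] {μ : Measure Ω}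

/-- All that drives the heads in slot `t`. -/
def drive (s : Network pbar lam τ μ) (t : ℕ) (ω : Ω) : Drive K :=
  (s.chan t ω, s.grant t ω, s.fresh t ω)

lemma measurable_drive (s : Network pbar lam τ μ) (t : ℕ) : Measurable (s.drive t) :=
  (s.measurable_chan t).prodMk ((s.measurable_grant t).prodMk (s.measurable_fresh t))

lemma measurable_hol (s : Network pbar lam τ μ) (t : ℕ) : Measurable (s.hol t) := by
  induction t with
  | zero => exact s.measurable_hol0
  | succ t ih =>
    exact (Measurable.of_discrete (f := fun p : (∀ n, Fin (K n)) × Drive K =>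
      driveNext p.1 p.2)).comp (ih.prodMk (s.measurable_drive t))

variable [IsProbabilityMeasure μ]

lemma integrable_drive (s : Network pbar lam τ μ) (t : ℕ) (F : Drive K → ℝ) :
    Integrable (fun ω => F (s.drive t ω)) μ :=
  have := Measure.isProbabilityMeasure_map (μ := μ) (s.measurable_drive t).aemeasurable
  (Integrable.of_finite (f := F) (μ := μ.map (s.drive t))).comp_measurable (s.measurable_drive t)

/-- Only the link of the head is inspected in each queue, so independence across queues suffices;
links of one queue may be dependent. -/
lemma integral_state (s : Network pbar lam τ μ) (t : ℕ) (h : ∀ n, Fin (K n)) (S : Fin N → Bool) :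
    ∫ ω, onIndicator (decide (driveState h (s.drive t ω) = S)) ∂μ = stateProb pbar h S := by
  have hm : ∀ n, Measurable fun ω => s.chan t ω n :=
    fun n => (measurable_pi_apply n).comp (s.measurable_chan t)
  rw [integral_onIndicator (b := fun ω => decide (driveState h (s.drive t ω) = S))
    ((Measurable.of_discrete (f := fun d : Drive K => decide (driveState h d = S))).comp
    (s.measurable_drive t))]
  have hset : {ω | decide (driveState h (s.drive t ω) = S) = true} =
      ⋂ n ∈ Finset.univ, (fun ω => s.chan t ω n) ⁻¹' {c | c (h n) = S n} := by
    ext ω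
    simp [driveState, drive, funext_iff]
  rw [hset, measureReal_def, (s.chan_indep t).measure_inter_preimage_eq_mul Finset.univ
    (fun n _ => MeasurableSet.of_discrete), ENNReal.toReal_prod, stateProb]
  refine Finset.prod_congr rfl fun n _ => ?_
  have hp := s.chan_prob t n (h n)
  cases hS : S n
  · have hc : ((fun ω => s.chan t ω n) ⁻¹' {c | c (h n) = false}) =
        {ω | s.chan t ω n (h n) = true}ᶜ := by
      ext ω; simp
    rw [hc, ← measureReal_def, probReal_compl_eq_one_sub, hp]
    · simp
    · exact hm n (MeasurableSet.of_discrete (s := {c : Fin (K n) → Bool | c (h n) = true}))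
  · exact hp

lemma integral_state_grant (s : Network pbar lam τ μ) (t : ℕ) (h : ∀ n, Fin (K n))
    (S : Fin N → Bool) (n : Fin N) :
    ∫ ω, onIndicator (decide (driveState h (s.drive t ω) = S)) *
      onIndicator ((s.drive t ω).2.1 S n) ∂μ = stateProb pbar h S * τ n S := by
  have hi := (s.grant_indep t).comp (φ := fun c => onIndicator (decide ((fun n => c n (h n)) = S)))
    (ψ := fun g => onIndicator (g S n)) Measurable.of_discrete Measurable.of_discrete
  have h1 := s.integrable_drive t (fun d => onIndicator (decide (driveState h d = S)))
  have h2 := s.integrable_drive t (fun d => onIndicator (d.2.1 S n))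
  have h3 := hi.integral_fun_mul_eq_mul_integral h1.aestronglyMeasurable h2.aestronglyMeasurable
  refine h3.trans ?_
  congr 1
  · exact s.integral_state t h S
  · refine (integral_onIndicator (b := fun ω => s.grant t ω S n) ?_).trans (s.grant_prob t S n)
    exact (Measurable.of_discrete (f := fun g : (Fin N → Bool) → Fin N → Bool => g S n)).comp
      (s.measurable_grant t)

lemma integral_state_grant_fresh (s : Network pbar lam τ μ) (t : ℕ) (h : ∀ n, Fin (K n))
    (S : Fin N → Bool) (n : Fin N) (F : Fin (K n) → ℝ) :
    ∫ ω, onIndicator (decide (driveState h (s.drive t ω) = S)) *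
      onIndicator ((s.drive t ω).2.1 S n) * F ((s.drive t ω).2.2 n) ∂μ =
        stateProb pbar h S * τ n S * ∑ k, alpha lam n k * F k := by
  have hi := (s.fresh_indep t).comp
    (φ := fun c => onIndicator (decide ((fun n => c.1 n (h n)) = S)) * onIndicator (c.2 S n))
    (ψ := fun g => F (g n)) Measurable.of_discrete Measurable.of_discrete
  have h1 := s.integrable_drive t (fun d => onIndicator (decide (driveState h d = S)) *
    onIndicator (d.2.1 S n))
  have h2 := s.integrable_drive t (fun d => F (d.2.2 n))
  have h3 := hi.integral_fun_mul_eq_mul_integral h1.aestronglyMeasurable h2.aestronglyMeasurable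
  refine h3.trans ?_
  congr 1
  · exact s.integral_state_grant t h S n
  · have e : ∀ ω, F (s.fresh t ω n) = ∑ k, onIndicator (decide (s.fresh t ω n = k)) * F k :=
      fun ω => (sum_onIndicator_decide_mul _ _).symm
    simp only [Function.comp_def]
    simp_rw [e]
    have hint : ∀ k, Integrable (fun ω => onIndicator (decide (s.fresh t ω n = k)) * F k) μ :=
      fun k => s.integrable_drive t (fun d => onIndicator (decide (d.2.2 n = k)) * F k)
    rw [integral_finsetSum _ fun k _ => hint k]
    refine Finset.sum_congr rfl fun k _ => ?_
    rw [integral_mul_const]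
    congr 1
    rw [integral_onIndicator (b := fun ω => decide (s.fresh t ω n = k))
      ((Measurable.of_discrete (f := fun d : Drive K => decide (d.2.2 n = k))).comp
      (s.measurable_drive t))]
    simpa using s.fresh_prob t n k

lemma integral_driveServes (s : Network pbar lam τ μ) (t : ℕ) (h : ∀ n, Fin (K n)) (n : Fin N) :
    ∫ ω, onIndicator (driveServes h (s.drive t ω) n) ∂μ = serviceProb pbar τ n h := by
  simp_rw [onIndicator_driveServes]
  rw [integral_finsetSum _ fun S _ => s.integrable_drive t fun d =>
    onIndicator (decide (driveState h d = S)) * (onIndicator (S n) * onIndicator (d.2.1 S n))]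
  refine Finset.sum_congr rfl fun S _ => ?_
  simp_rw [mul_left_comm _ (onIndicator (S n))]
  rw [integral_const_mul, integral_state_grant]

lemma integral_driveNext (s : Network pbar lam τ μ) (t : ℕ) (u : (∀ n, Fin (K n)) → ℝ)
    (h : ∀ n, Fin (K n)) :
    ∫ ω, u (driveNext h (s.drive t ω)) ∂μ = meanNext pbar lam τ u h := by
  -- The weights sum to one because they are the law of the new head.
  have hlam : ∀ n, ∑ k, alpha lam n k = 1 := by
    intro n
    have hm : Measurable fun ω => s.fresh t ω n :=
      (measurable_pi_apply n).comp (s.measurable_fresh t)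
    have := Measure.isProbabilityMeasure_map (μ := μ) hm.aemeasurable
    have h1 := sum_measureReal_singleton (μ := μ.map fun ω => s.fresh t ω n) Finset.univ
    rw [Finset.coe_univ, probReal_univ] at h1
    rw [← h1]
    refine Finset.sum_congr rfl fun k _ => ?_
    rw [map_measureReal_apply hm (measurableSet_singleton k), ← s.fresh_prob t n k]
    rfl
  have e : ∀ ω, u (driveNext h (s.drive t ω)) = (∑ n, ∑ S, onIndicator (S n) *
      (onIndicator (decide (driveState h (s.drive t ω) = S)) *
        onIndicator ((s.drive t ω).2.1 S n) *
          (u (Function.update h n ((s.drive t ω).2.2 n)) - u h))) + u h := by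
    intro ω
    rw [driveNext_eq (d := s.drive t ω) (s.grant_unique t ω) u]
    congr 1
    refine Finset.sum_congr rfl fun n _ => ?_
    rw [onIndicator_driveServes, Finset.sum_mul]
    exact Finset.sum_congr rfl fun S _ => by ring
  simp_rw [e]
  rw [integral_add (s.integrable_drive t fun d => ∑ n, ∑ S, onIndicator (S n) *
      (onIndicator (decide (driveState h d = S)) * onIndicator (d.2.1 S n) *
          (u (Function.update h n (d.2.2 n)) - u h))) (integrable_const _),
    integral_finsetSum _ fun n _ => s.integrable_drive t fun d => ∑ S, onIndicator (S n) *
      (onIndicator (decide (driveState h d = S)) * onIndicator (d.2.1 S n) *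
          (u (Function.update h n (d.2.2 n)) - u h))]
  have e2 : ∀ n, ∫ ω, ∑ S, onIndicator (S n) *
      (onIndicator (decide (driveState h (s.drive t ω) = S)) *
        onIndicator ((s.drive t ω).2.1 S n) *
          (u (Function.update h n ((s.drive t ω).2.2 n)) - u h)) ∂μ =
      ∑ S, onIndicator (S n) * (stateProb pbar h S * τ n S *
        ∑ k, alpha lam n k * (u (Function.update h n k) - u h)) := by
    intro n
    rw [integral_finsetSum _ fun S _ => s.integrable_drive t fun d => onIndicator (S n) *
      (onIndicator (decide (driveState h d = S)) * onIndicator (d.2.1 S n) *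
          (u (Function.update h n (d.2.2 n)) - u h))]
    refine Finset.sum_congr rfl fun S _ => ?_
    rw [integral_const_mul,
      s.integral_state_grant_fresh t h S n fun k => u (Function.update h n k) - u h]
  simp_rw [e2, mul_sub, Finset.sum_sub_distrib, ← Finset.sum_mul, hlam, one_mul]
  rw [Finset.sum_comm]
  unfold meanNext
  simp only [integral_const, probReal_univ, one_smul]
  have e3 : u h = ∑ S, stateProb pbar h S * u h := by
    rw [← Finset.sum_mul, sum_stateProb, one_mul]
  nth_rewrite 2 [e3]
  rw [← Finset.sum_add_distrib]
  refine Finset.sum_congr rfl fun S _ => ?_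
  rw [mul_add, sub_mul, mul_sub, one_mul, Finset.sum_mul, Finset.mul_sum, Finset.mul_sum,
    add_sub_assoc', ← sub_eq_zero]
  have e4 : ∑ n, onIndicator (S n) * (stateProb pbar h S * τ n S *
      ∑ k, alpha lam n k * u (Function.update h n k) - stateProb pbar h S * τ n S * u h) =
      ∑ n, stateProb pbar h S * (onIndicator (S n) * τ n S *
        ∑ k, alpha lam n k * u (Function.update h n k)) -
      ∑ n, stateProb pbar h S * (onIndicator (S n) * τ n S * u h) := by
    rw [← Finset.sum_sub_distrib]
    exact Finset.sum_congr rfl fun n _ => by ring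
  have e5 : ∑ n, stateProb pbar h S * (onIndicator (S n) * τ n S * u h) =
      stateProb pbar h S * ∑ n, onIndicator (S n) * τ n S * u h := by
    rw [Finset.mul_sum]
  simp only [mul_sub] at e4 ⊢
  linarith

end Network

/-! ### Comparison queues and drift inequalities. -/

/-- The queue of service `g` and arrivals `a` that is empty at time zero. -/
noncomputable def lindley {Ω : Type*} (g a : ℕ → Ω → ℝ) : ℕ → Ω → ℝ
  | 0, _ => 0
  | t + 1, ω => max (lindley g a t ω - g t ω) 0 + a t ω

section Lindley

variable {Ω : Type*} {g a : ℕ → Ω → ℝ}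

lemma lindley_nonneg (ha : ∀ t ω, 0 ≤ a t ω) (t : ℕ) (ω : Ω) : 0 ≤ lindley g a t ω := by
  cases t with
  | zero => exact le_rfl
  | succ t => exact add_nonneg (le_max_right _ _) (ha t ω)

lemma integral_lindley_nonneg [MeasurableSpace Ω] {μ : Measure Ω} (ha : ∀ t ω, 0 ≤ a t ω) (t : ℕ) :
    0 ≤ ∫ ω, lindley g a t ω ∂μ := integral_nonneg fun ω => lindley_nonneg ha t ω

lemma lindley_succ_sq_le (hg : ∀ t ω, 0 ≤ g t ω) (ha : ∀ t ω, 0 ≤ a t ω) (t : ℕ) (ω : Ω) :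
    lindley g a (t + 1) ω ^ 2 ≤ lindley g a t ω ^ 2 + (g t ω ^ 2 + a t ω ^ 2) +
      2 * (lindley g a t ω * a t ω - lindley g a t ω * g t ω) := by
  have hq := lindley_nonneg (g := g) ha t ω
  have hg := hg t ω
  have ha := ha t ω
  simp only [lindley]
  rcases le_total (lindley g a t ω - g t ω) 0 with h | h
  · rw [max_eq_right h]
    nlinarith [mul_nonneg hq ha, sq_nonneg (lindley g a t ω - g t ω)]
  · rw [max_eq_left h]
    nlinarith [mul_nonneg hg ha]

/-- Bounded increments let the corrector be moved from one queue size to the next at bounded cost.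
-/
lemma abs_lindley_sub_succ_le {c : ℝ} (hg : ∀ t ω, 0 ≤ g t ω) (hg1 : ∀ t ω, g t ω ≤ 1)
    (hc : 0 ≤ c) (t : ℕ) (ω : Ω) :
    |lindley g (fun _ _ => c) t ω - lindley g (fun _ _ => c) (t + 1) ω| ≤ 1 + c := by
  have hq := lindley_nonneg (g := g) (a := fun _ _ => c) (fun _ _ => hc) t ω
  have := hg t ω
  have := hg1 t ω
  simp only [lindley]
  rw [abs_le]
  rcases le_total (lindley g (fun _ _ => c) t ω - g t ω) 0 with h | h
  · rw [max_eq_right h]; constructor <;> linarith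
  · rw [max_eq_left h]; constructor <;> linarith

lemma memLp_lindley [MeasurableSpace Ω] {μ : Measure Ω} [IsFiniteMeasure μ]
    (hg : ∀ t, MemLp (g t) 2 μ) (ha : ∀ t, MemLp (a t) 2 μ) (t : ℕ) :
    MemLp (lindley g a t) 2 μ := by
  induction t with
  | zero => exact memLp_const 0
  | succ t ih =>
    have h1 : MemLp (lindley g a t - g t) 2 μ := ih.sub (hg t)
    exact h1.pos_part.add (ha t)

/-- A queue is dominated by the sum of two queues that separate its arrivals from its service. -/
lemma le_lindley_add_lindley {q : ℕ → Ω → ℝ} {b : Ω → ℝ} {c : ℝ} (hc : 0 ≤ c)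
    (hb : ∀ ω, 0 ≤ b ω) (h0 : ∀ ω, q 0 ω = b ω)
    (hq : ∀ t ω, q (t + 1) ω = max (q t ω - g t ω) 0 + a t ω) (t : ℕ) (ω : Ω) :
    q t ω ≤ b ω + lindley (fun _ _ => c) a t ω + lindley g (fun _ _ => c) t ω := by
  induction t with
  | zero => simp [h0, lindley]
  | succ t ih =>
    rw [hq]
    simp only [lindley]
    -- In each slot the amount `c` taken from the first queue is added to the second, so it cancels
    -- in their sum.
    have h1 := le_max_left (lindley (fun _ _ => c) a t ω - c) 0
    have h2 := le_max_right (lindley (fun _ _ => c) a t ω - c) 0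
    have h3 := le_max_left (lindley g (fun _ _ => c) t ω - g t ω) 0
    have h4 := le_max_right (lindley g (fun _ _ => c) t ω - g t ω) 0
    have h5 := hb ω
    rcases le_total (q t ω - g t ω) 0 with h | h
    · rw [max_eq_right h]; linarith
    · rw [max_eq_left h]; linarith

end Lindley

section Lyapunov

/-- Summing a drift inequality with a corrector `D`. -/
lemma drift_bound {m L D : ℕ → ℝ} {C B ε : ℝ} (hL0 : L 0 = 0)
    (hmL : ∀ t, m t ^ 2 ≤ L t) (hD0 : D 0 = 0) (hD : ∀ t, D t ≤ B * m t)
    (hstep : ∀ t, L (t + 1) ≤ L t + C - 2 * ε * m t + 2 * (D (t + 1) - D t)) (T : ℕ) :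
    (m T - B) ^ 2 + 2 * ε * ∑ t ∈ Finset.range T, m t ≤ C * T + B ^ 2 := by
  have h : L T + 2 * ε * ∑ t ∈ Finset.range T, m t ≤ C * T + 2 * D T := by
    induction T with
    | zero => simp [hL0, hD0]
    | succ T ih =>
      rw [Finset.sum_range_succ]
      push_cast
      linarith [hstep T]
  -- Bound 2 D by 2 B m, then complete the square.
  nlinarith [hmL T, hD T]

lemma tendsto_div_of_sq_le {m : ℕ → ℝ} {C B : ℝ} (hm : ∀ T, 0 ≤ m T)
    (h : ∀ T : ℕ, (m T - B) ^ 2 ≤ C * T + B ^ 2) :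
    Tendsto (fun T : ℕ => m T / T) atTop (𝓝 0) := by
  have h1 : Tendsto (fun T : ℕ => (2 * |C| + 4 * B ^ 2) / (T : ℝ)) atTop (𝓝 0) :=
    tendsto_const_div_atTop_nhds_zero_nat _
  have h2 : Tendsto (fun T : ℕ => √((2 * |C| + 4 * B ^ 2) / (T : ℝ))) atTop (𝓝 0) := by
    have h3 := (Real.continuous_sqrt.tendsto 0).comp h1
    rwa [Real.sqrt_zero] at h3
  refine squeeze_zero' (Eventually.of_forall fun T => div_nonneg (hm T) (Nat.cast_nonneg T)) ?_ h2
  filter_upwards [eventually_ge_atTop 1] with T hT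
  have hT' : (1 : ℝ) ≤ T := by exact_mod_cast hT
  apply Real.le_sqrt_of_sq_le
  rw [div_pow, sq (T : ℝ), ← div_div]
  gcongr
  rw [div_le_iff₀ (by linarith)]
  have := h T
  have h3 : C * T ≤ |C| * T := mul_le_mul_of_nonneg_right (le_abs_self C) (by linarith)
  -- m² ≤ 2(m - B)² + 2B², the difference being (m - 2B)².
  nlinarith [sq_nonneg (m T - 2 * B), mul_nonneg (sq_nonneg B) (sub_nonneg.2 hT')]

lemma sum_div_le_of_drift {m : ℕ → ℝ} {C B ε : ℝ} (hε : 0 < ε)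
    (h : ∀ T : ℕ, (m T - B) ^ 2 + 2 * ε * ∑ t ∈ Finset.range T, m t ≤ C * T + B ^ 2) (T : ℕ)
    (hT : 1 ≤ T) : (∑ t ∈ Finset.range T, m t) / T ≤ (C + B ^ 2) / (2 * ε) := by
  have hT' : (1 : ℝ) ≤ T := by exact_mod_cast hT
  rw [div_le_div_iff₀ (by linarith) (by linarith)]
  nlinarith [h T, sq_nonneg (m T - B), mul_nonneg (sq_nonneg B) (sub_nonneg.2 hT')]

lemma sq_integral_le {Ω : Type*} [MeasurableSpace Ω] {μ : Measure Ω} [IsProbabilityMeasure μ]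
    {f : Ω → ℝ} (hf : MemLp f 2 μ) : (∫ ω, f ω ∂μ) ^ 2 ≤ ∫ ω, f ω ^ 2 ∂μ := by
  have h := variance_nonneg f μ
  rw [variance_eq_sub hf] at h
  simpa using h

end Lyapunov

/-! ### Moment bounds for the queues of the network. -/

namespace Network

variable {N : ℕ} {K : Fin N → ℕ} {pbar lam : ∀ n, Fin (K n) → ℝ}
  {τ : Fin N → (Fin N → Bool) → ℝ} {Ω : Type*} [MeasurableSpace Ω] {μ : Measure Ω}

/-- Total arrivals to queue `n` in slot `t`. -/
noncomputable def input (s : Network pbar lam τ μ) (n : Fin N) (t : ℕ) (ω : Ω) : ℝ :=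
  ∑ k, s.arr t ω n k

/-- The service process of queue `n`. -/
noncomputable def output (s : Network pbar lam τ μ) (n : Fin N) (t : ℕ) (ω : Ω) : ℝ :=
  s.service t ω n

lemma input_nonneg (s : Network pbar lam τ μ) (n : Fin N) (t : ℕ) (ω : Ω) : 0 ≤ s.input n t ω :=
  Finset.sum_nonneg fun k _ => s.arr_nonneg t ω n k

lemma output_nonneg (s : Network pbar lam τ μ) (n : Fin N) (t : ℕ) (ω : Ω) :
    0 ≤ s.output n t ω := onIndicator_nonneg _

lemma output_le_one (s : Network pbar lam τ μ) (n : Fin N) (t : ℕ) (ω : Ω) :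
    s.output n t ω ≤ 1 := onIndicator_le_one _

lemma measurable_output (s : Network pbar lam τ μ) (n : Fin N) (t : ℕ) :
    Measurable (s.output n t) :=
  (Measurable.of_discrete (f := fun p : (∀ n, Fin (K n)) × Drive K =>
    onIndicator (driveServes p.1 p.2 n))).comp ((s.measurable_hol t).prodMk (s.measurable_drive t))

lemma measurable_input (s : Network pbar lam τ μ) (n : Fin N) (t : ℕ) :
    Measurable (s.input n t) :=
  Finset.measurable_sum _ fun k _ =>
    (measurable_pi_apply k).comp ((measurable_pi_apply n).comp (s.measurable_arr t))

lemma memLp_input (s : Network pbar lam τ μ) (n : Fin N) (t : ℕ) : MemLp (s.input n t) 2 μ :=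
  memLp_finsetSum _ fun k _ => s.arr_memLp t n k

lemma integral_input_sq (s : Network pbar lam τ μ) (n : Fin N) (t : ℕ) :
    ∫ ω, s.input n t ω ^ 2 ∂μ = ∫ ω, s.input n 0 ω ^ 2 ∂μ := by
  have hm : Measurable fun x : ∀ n, Fin (K n) → ℝ => (∑ k, x n k) ^ 2 := by fun_prop
  exact ((s.arr_ident t).comp hm).integral_eq

lemma backlog_nonneg (s : Network pbar lam τ μ) (n : Fin N) (t : ℕ) (ω : Ω) :
    0 ≤ s.backlog t ω n := by
  cases t with
  | zero => exact s.backlog0_nonneg ω n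
  | succ t => exact add_nonneg (le_max_right _ _) (s.input_nonneg n t ω)

variable [IsProbabilityMeasure μ]

lemma memLp_output (s : Network pbar lam τ μ) (n : Fin N) (t : ℕ) : MemLp (s.output n t) 2 μ :=
  MemLp.of_bound (s.measurable_output n t).aestronglyMeasurable 1 (Eventually.of_forall fun ω => by
    rw [Real.norm_of_nonneg (s.output_nonneg n t ω)]; exact s.output_le_one n t ω)

lemma integral_input (s : Network pbar lam τ μ) (n : Fin N) (t : ℕ) :
    ∫ ω, s.input n t ω ∂μ = ∑ k, lam n k := by
  unfold input
  rw [integral_finsetSum _ fun k _ => (s.arr_memLp t n k).integrable (by norm_num)]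
  simp_rw [s.arr_mean]

/-- Second-moment drift of a queue of constant service whose input is that of queue `n`. -/
lemma drift_input (s : Network pbar lam τ μ) (n : Fin N) {c : ℝ} (hc : 0 ≤ c) (T : ℕ) :
    ((∫ ω, lindley (fun _ _ => c) (s.input n) T ω ∂μ) - 0) ^ 2 + 2 * (c - ∑ k, lam n k) *
      ∑ t ∈ Finset.range T, ∫ ω, lindley (fun _ _ => c) (s.input n) t ω ∂μ ≤
      (c ^ 2 + ∫ ω, s.input n 0 ω ^ 2 ∂μ) * T + 0 ^ 2 := by
  set Q := lindley (fun _ _ => c) (s.input n) with hQ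
  have hL2 : ∀ t, MemLp (Q t) 2 μ := memLp_lindley (fun _ => memLp_const c) (s.memLp_input n)
  have hQi : ∀ t, Integrable (Q t) μ := fun t => (hL2 t).integrable (by norm_num)
  have hmeas : ∀ t, Measurable (Q t) := by
    intro t
    induction t with
    | zero => exact measurable_const
    | succ t ih => exact ((ih.sub_const c).max measurable_const).add (s.measurable_input n t)
  have hF : Measurable fun p : ℝ × (∀ n, Fin (K n) → ℝ) => max (p.1 - c) 0 + ∑ k, p.2 n k := by
    fun_prop
  have hind : ∀ t, IndepFun (Q t) (s.arr t) μ :=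
    indepFun_of_recursion s.measurable_arr hmeas s.arr_indep
      (indepFun_const_left (0 : ℝ) _) hF (fun t ω => rfl)
  have hind' : ∀ t, IndepFun (Q t) (s.input n t) μ := fun t =>
    (hind t).comp measurable_id
      (ψ := fun x : ∀ n, Fin (K n) → ℝ => ∑ k, x n k) (by fun_prop)
  have hinp : ∀ t, Integrable (s.input n t) μ := fun t => (s.memLp_input n t).integrable (by norm_num)
  have hmul : ∀ t, ∫ ω, Q t ω * s.input n t ω ∂μ = (∫ ω, Q t ω ∂μ) * ∑ k, lam n k := by
    intro t
    rw [(hind' t).integral_fun_mul_eq_mul_integral (hQi t).aestronglyMeasurable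
      (hinp t).aestronglyMeasurable, integral_input]
  have hmuli : ∀ t, Integrable (fun ω => Q t ω * s.input n t ω) μ :=
    fun t => (hind' t).integrable_mul (hQi t) (hinp t)
  -- Arrivals are independent of the present queue, so the corrector is zero; hence the `- 0` and `0
  -- ^ 2` in the statement.
  refine drift_bound (m := fun t => ∫ ω, Q t ω ∂μ) (L := fun t => ∫ ω, Q t ω ^ 2 ∂μ)
    (D := fun _ => 0) (by simp [hQ, lindley]) (fun t => sq_integral_le (hL2 t)) rfl
    (fun t => by simp) (fun t => ?_) T
  have h1 : ∫ ω, Q (t + 1) ω ^ 2 ∂μ ≤ ∫ ω, (Q t ω ^ 2 + (c ^ 2 + s.input n t ω ^ 2) +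
      2 * (Q t ω * s.input n t ω - Q t ω * c)) ∂μ := by
    refine integral_mono (hL2 _).integrable_sq ?_ fun ω =>
      lindley_succ_sq_le (fun _ _ => hc) (s.input_nonneg n) t ω
    exact ((hL2 t).integrable_sq.add
      ((integrable_const _).add (s.memLp_input n t).integrable_sq)).add
      (((hmuli t).sub ((hQi t).mul_const c)).const_mul 2)
  rw [integral_add, integral_add (hL2 t).integrable_sq, integral_add (integrable_const _)
    (s.memLp_input n t).integrable_sq, integral_const_mul, integral_sub (hmuli t)
    ((hQi t).mul_const c), hmul, integral_mul_const, integral_input_sq] at h1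
  · simp only [integral_const, probReal_univ, one_smul] at h1
    linarith
  · exact (integrable_const _).add (s.memLp_input n t).integrable_sq
  · exact (hL2 t).integrable_sq.add ((integrable_const _).add (s.memLp_input n t).integrable_sq)
  · exact ((hmuli t).sub ((hQi t).mul_const c)).const_mul 2

/-- The queue of constant input `c` and the service of queue `n`, jointly with the heads, is
independent of the present link states and decisions. -/
lemma indepFun_lindley_hol_drive (s : Network pbar lam τ μ) (n : Fin N) (c : ℝ) (t : ℕ) :
    IndepFun (fun ω => (lindley (s.output n) (fun _ _ => c) t ω, s.hol t ω)) (s.drive t) μ := by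
  have hmeas : ∀ t, Measurable (lindley (s.output n) (fun _ _ => c) t) := by
    intro t
    induction t with
    | zero => exact measurable_const
    | succ t ih => exact ((ih.sub (s.measurable_output n t)).max measurable_const).add_const c
  have h1 : Measurable fun p : (ℝ × (∀ n, Fin (K n))) × Drive K =>
      onIndicator (driveServes p.1.2 p.2 n) :=
    (Measurable.of_discrete (f := fun p : (∀ n, Fin (K n)) × Drive K =>
      onIndicator (driveServes p.1 p.2 n))).comp (measurable_fst.snd.prodMk measurable_snd)
  have h2 : Measurable fun p : (ℝ × (∀ n, Fin (K n))) × Drive K => driveNext p.1.2 p.2 :=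
    (Measurable.of_discrete (f := fun p : (∀ n, Fin (K n)) × Drive K =>
      driveNext p.1 p.2)).comp (measurable_fst.snd.prodMk measurable_snd)
  have hF : Measurable fun p : (ℝ × (∀ n, Fin (K n))) × Drive K =>
      (max (p.1.1 - onIndicator (driveServes p.1.2 p.2 n)) 0 + c, driveNext p.1.2 p.2) :=
    (((measurable_fst.fst.sub h1).max measurable_const).add_const c).prodMk h2
  refine indepFun_of_recursion (x := s.drive)
    (z := fun t ω => (lindley (s.output n) (fun _ _ => c) t ω, s.hol t ω))
    s.measurable_drive (fun t => (hmeas t).prodMk (s.measurable_hol t)) s.drive_indep ?_ hF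
    (fun t ω => rfl) t
  -- The comparison queue starts at the constant 0, so the initial backlog, about whose dependence
  -- nothing is known, does not enter.
  exact s.hol0_indep.comp (φ := fun h => ((0 : ℝ), h)) (measurable_const.prodMk measurable_id)
    measurable_id

/-- Second-moment drift of a queue of constant input that is served like queue `n`. -/
lemma drift_output (s : Network pbar lam τ μ) (n : Fin N) {u : (∀ n, Fin (K n)) → ℝ}
    (hu : ∀ h, serviceProb pbar τ n h - serviceRate pbar lam τ n = u h - meanNext pbar lam τ u h)
    {U : ℝ} (hU : ∀ h, |u h| ≤ U) {c : ℝ} (hc : 0 ≤ c) (T : ℕ) :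
    ((∫ ω, lindley (s.output n) (fun _ _ => c) T ω ∂μ) - U) ^ 2 +
      2 * (serviceRate pbar lam τ n - c) *
      ∑ t ∈ Finset.range T, ∫ ω, lindley (s.output n) (fun _ _ => c) t ω ∂μ ≤
      (1 + c ^ 2 + 2 * ((1 + c) * U)) * T + U ^ 2 := by
  set Q := lindley (s.output n) (fun _ _ => c) with hQ
  have hL2 : ∀ t, MemLp (Q t) 2 μ := memLp_lindley (s.memLp_output n) (fun _ => memLp_const c)
  have hQi : ∀ t, Integrable (Q t) μ := fun t => (hL2 t).integrable (by norm_num)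
  have hQ0 : ∀ t ω, 0 ≤ Q t ω := lindley_nonneg fun _ _ => hc
  have hmeas : ∀ t, Measurable (Q t) := by
    intro t
    induction t with
    | zero => exact measurable_const
    | succ t ih => exact ((ih.sub (s.measurable_output n t)).max measurable_const).add_const c
  have hind := s.indepFun_lindley_hol_drive n c
  have hQg : ∀ t, Integrable (fun ω => Q t ω * s.output n t ω) μ ∧
      ∫ ω, Q t ω * s.output n t ω ∂μ = ∫ ω, Q t ω * serviceProb pbar τ n (s.hol t ω) ∂μ := by
    intro t
    have := integral_mul_apply_of_indepFun ((hmeas t).prodMk (s.measurable_hol t)) (hind t)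
      (h := Prod.snd) measurable_snd (G := Prod.fst) measurable_fst (hQi t)
      (F := fun h d => onIndicator (driveServes h d n)) (fun _ => Measurable.of_discrete)
      (fun h => s.integrable_drive t fun d => onIndicator (driveServes h d n))
    simp_rw [s.integral_driveServes t] at this
    exact this
  have hQu : ∀ t, Integrable (fun ω => Q t ω * u (s.hol (t + 1) ω)) μ ∧
      ∫ ω, Q t ω * u (s.hol (t + 1) ω) ∂μ =
        ∫ ω, Q t ω * meanNext pbar lam τ u (s.hol t ω) ∂μ := by
    intro t
    have := integral_mul_apply_of_indepFun ((hmeas t).prodMk (s.measurable_hol t)) (hind t)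
      (h := Prod.snd) measurable_snd (G := Prod.fst) measurable_fst (hQi t)
      (F := fun h d => u (driveNext h d)) (fun _ => Measurable.of_discrete)
      (fun h => s.integrable_drive t fun d => u (driveNext h d))
    simp_rw [s.integral_driveNext t] at this
    exact this
  have hQf : ∀ t (v : (∀ n, Fin (K n)) → ℝ), Integrable (fun ω => Q t ω * v (s.hol t ω)) μ := by
    intro t v
    obtain ⟨V, hV⟩ := (Set.finite_range fun h => |v h|).bddAbove
    refine (hQi t).mul_bdd (c := V)
      (Measurable.of_discrete.comp (s.measurable_hol t)).aestronglyMeasurable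
      (Eventually.of_forall fun ω => hV ⟨_, rfl⟩)
  refine drift_bound (m := fun t => ∫ ω, Q t ω ∂μ) (L := fun t => ∫ ω, Q t ω ^ 2 ∂μ)
    (D := fun t => ∫ ω, Q t ω * u (s.hol t ω) ∂μ) (by simp [hQ, lindley])
    (fun t => sq_integral_le (hL2 t)) (by simp [hQ, lindley]) (fun t => ?_) (fun t => ?_) T
  · rw [← integral_const_mul]
    refine integral_mono (hQf t u) ((hQi t).const_mul U) fun ω => ?_
    simp only
    rw [mul_comm U]
    exact mul_le_mul_of_nonneg_left ((le_abs_self _).trans (hU _)) (hQ0 t ω)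
  · have hU0 : 0 ≤ U := (abs_nonneg _).trans (hU (s.hol t (Classical.choice
      (nonempty_of_isProbabilityMeasure μ))))
    have h1 : ∫ ω, Q (t + 1) ω ^ 2 ∂μ ≤ ∫ ω, (Q t ω ^ 2 + (1 + c ^ 2) +
        2 * (Q t ω * c - Q t ω * s.output n t ω)) ∂μ := by
      refine integral_mono (hL2 _).integrable_sq ?_ fun ω =>
        (lindley_succ_sq_le (s.output_nonneg n) (fun _ _ => hc) t ω).trans ?_
      · exact ((hL2 t).integrable_sq.add (integrable_const _)).add
          ((((hQi t).mul_const c).sub (hQg t).1).const_mul 2)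
      · have h0 := s.output_nonneg n t ω
        have h1 := s.output_le_one n t ω
        have : s.output n t ω ^ 2 ≤ 1 := by nlinarith
        simp only [← hQ]
        linarith
    rw [integral_add, integral_add (hL2 t).integrable_sq (integrable_const _), integral_const_mul,
      integral_sub ((hQi t).mul_const c) (hQg t).1, integral_mul_const, (hQg t).2] at h1
    rotate_left
    · exact (hL2 t).integrable_sq.add (integrable_const _)
    · exact (((hQi t).mul_const c).sub (hQg t).1).const_mul 2
    simp only [integral_const, probReal_univ, one_smul] at h1
    -- The Poisson equation replaces the service probability by its long-run rate plus u - Pu, and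
    -- `hQu` turns Pu(H_t) into u(H_{t+1}) under the weight Q_t.
    have h2 : ∫ ω, Q t ω * serviceProb pbar τ n (s.hol t ω) ∂μ =
        (∫ ω, Q t ω ∂μ) * serviceRate pbar lam τ n + ∫ ω, Q t ω * u (s.hol t ω) ∂μ -
          ∫ ω, Q t ω * u (s.hol (t + 1) ω) ∂μ := by
      have hi : Integrable (fun ω => Q t ω * serviceRate pbar lam τ n + Q t ω * u (s.hol t ω)) μ :=
        ((hQi t).mul_const _).add (hQf t u)
      rw [(hQu t).2, ← integral_mul_const, ← integral_add ((hQi t).mul_const _) (hQf t u),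
        ← integral_sub hi (hQf t _)]
      refine integral_congr_ae (Eventually.of_forall fun ω => ?_)
      simp only
      rw [show serviceProb pbar τ n (s.hol t ω) = serviceRate pbar lam τ n + u (s.hol t ω) -
        meanNext pbar lam τ u (s.hol t ω) by linarith [hu (s.hol t ω)]]
      ring
    -- To telescope, the corrector at time t + 1 must carry Q_{t+1}; the exchange costs (1 + c)U.
    have h3 : ∫ ω, Q t ω * u (s.hol (t + 1) ω) ∂μ ≤
        ∫ ω, Q (t + 1) ω * u (s.hol (t + 1) ω) ∂μ + (1 + c) * U := by
      have : (1 + c) * U = ∫ _, (1 + c) * U ∂μ := by simp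
      rw [this, ← integral_add (hQf (t + 1) u) (integrable_const _)]
      refine integral_mono (hQu t).1 ((hQf (t + 1) u).add (integrable_const _)) fun ω => ?_
      have h4 : (Q t ω - Q (t + 1) ω) * u (s.hol (t + 1) ω) ≤ (1 + c) * U := by
        refine (le_abs_self _).trans ?_
        rw [abs_mul]
        exact mul_le_mul (abs_lindley_sub_succ_le (s.output_nonneg n) (s.output_le_one n) hc t ω)
          (hU _) (abs_nonneg _) (by linarith)
      simp only
      linarith
    rw [h2] at h1
    linarith

lemma integrable_backlog (s : Network pbar lam τ μ) (n : Fin N) (t : ℕ) :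
    Integrable (fun ω => s.backlog t ω n) μ := by
  induction t with
  | zero => exact s.integrable_backlog0 n
  | succ t ih =>
    have h1 := (ih.sub ((s.memLp_output n t).integrable (by norm_num))).pos_part
    exact h1.add ((s.memLp_input n t).integrable (by norm_num))

lemma integral_backlog_le (s : Network pbar lam τ μ) (n : Fin N) {c : ℝ} (hc : 0 ≤ c) (t : ℕ) :
    ∫ ω, s.backlog t ω n ∂μ ≤ ∫ ω, s.backlog0 ω n ∂μ +
      ∫ ω, lindley (fun _ _ => c) (s.input n) t ω ∂μ +
      ∫ ω, lindley (s.output n) (fun _ _ => c) t ω ∂μ := by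
  have h1 : Integrable (lindley (fun _ _ => c) (s.input n) t) μ :=
    (memLp_lindley (fun _ => memLp_const c) (s.memLp_input n) t).integrable (by norm_num)
  have h2 : Integrable (lindley (s.output n) (fun _ _ => c) t) μ :=
    (memLp_lindley (s.memLp_output n) (fun _ => memLp_const c) t).integrable (by norm_num)
  have h3 : Integrable (fun ω => s.backlog0 ω n + lindley (fun _ _ => c) (s.input n) t ω) μ :=
    (s.integrable_backlog0 n).add h1
  rw [← integral_add (s.integrable_backlog0 n) h1, ← integral_add h3 h2]
  exact integral_mono (s.integrable_backlog n t) (h3.add h2)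
    fun ω => le_lindley_add_lindley (q := fun t ω => s.backlog t ω n)
      (b := fun ω => s.backlog0 ω n) hc (fun ω => s.backlog0_nonneg ω n)
      (fun _ => rfl) (fun _ _ => rfl) t ω

/-- Dropping the maximum gives Q(t+1) ≥ Q(t) - g(t) + arrivals. The expected services telescope
through u, and 2U covers the two boundary terms. -/
lemma le_integral_backlog (s : Network pbar lam τ μ) (n : Fin N) {u : (∀ n, Fin (K n)) → ℝ}
    (hu : ∀ h, serviceProb pbar τ n h - serviceRate pbar lam τ n = u h - meanNext pbar lam τ u h)
    {U : ℝ} (hU : ∀ h, |u h| ≤ U) (T : ℕ) :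
    (∑ k, lam n k - serviceRate pbar lam τ n) * T - 2 * U ≤ ∫ ω, s.backlog T ω n ∂μ := by
  have hui : ∀ t (v : (∀ n, Fin (K n)) → ℝ), Integrable (fun ω => v (s.hol t ω)) μ := fun t v =>
    have := Measure.isProbabilityMeasure_map (μ := μ) (s.measurable_hol t).aemeasurable
    (Integrable.of_finite (f := v) (μ := μ.map (s.hol t))).comp_measurable (s.measurable_hol t)
  have hind : ∀ t, IndepFun (s.hol t) (s.drive t) μ := fun t =>
    (s.indepFun_lindley_hol_drive n 0 t).comp measurable_snd measurable_id
  have hg : ∀ t, ∫ ω, s.output n t ω ∂μ = serviceRate pbar lam τ n + ∫ ω, u (s.hol t ω) ∂μ -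
      ∫ ω, u (s.hol (t + 1) ω) ∂μ := by
    intro t
    have h1 := (integral_mul_apply_of_indepFun (s.measurable_hol t) (hind t) (h := id)
      measurable_id (G := fun _ => 1) measurable_const (integrable_const _)
      (F := fun h d => onIndicator (driveServes h d n)) (fun _ => Measurable.of_discrete)
      (fun h => s.integrable_drive t fun d => onIndicator (driveServes h d n))).2
    have h2 := (integral_mul_apply_of_indepFun (s.measurable_hol t) (hind t) (h := id)
      measurable_id (G := fun _ => 1) measurable_const (integrable_const _)
      (F := fun h d => u (driveNext h d)) (fun _ => Measurable.of_discrete)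
      (fun h => s.integrable_drive t fun d => u (driveNext h d))).2
    simp only [one_mul, id, s.integral_driveServes t] at h1
    simp only [one_mul, id, s.integral_driveNext t] at h2
    have e : ∀ h, serviceProb pbar τ n h = serviceRate pbar lam τ n + u h -
      meanNext pbar lam τ u h := fun h => by linarith [hu h]
    refine h1.trans ?_
    simp_rw [e]
    rw [integral_sub (hui t fun h => serviceRate pbar lam τ n + u h) (hui t _), integral_add (integrable_const _) (hui t u), ← h2]
    simp
    rfl
  have hb : ∀ t, |∫ ω, u (s.hol t ω) ∂μ| ≤ U := by
    intro t
    have := norm_integral_le_of_norm_le_const (μ := μ) (f := fun ω => u (s.hol t ω)) (C := U)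
      (Eventually.of_forall fun ω => hU _)
    simpa using this
  have key : (∑ k, lam n k - serviceRate pbar lam τ n) * T - ∫ ω, u (s.hol 0 ω) ∂μ +
      ∫ ω, u (s.hol T ω) ∂μ ≤ ∫ ω, s.backlog T ω n ∂μ := by
    induction T with
    | zero =>
      have : 0 ≤ ∫ ω, s.backlog 0 ω n ∂μ := integral_nonneg fun ω => s.backlog_nonneg n 0 ω
      simpa using this
    | succ T ih =>
      have ho : Integrable (s.output n T) μ := (s.memLp_output n T).integrable (by norm_num)
      have hi : Integrable (s.input n T) μ := (s.memLp_input n T).integrable (by norm_num)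
      have h1 : ∫ ω, s.backlog T ω n ∂μ - ∫ ω, s.output n T ω ∂μ + ∫ ω, s.input n T ω ∂μ ≤
          ∫ ω, s.backlog (T + 1) ω n ∂μ := by
        have hd : Integrable (fun ω => s.backlog T ω n - s.output n T ω) μ :=
          (s.integrable_backlog n T).sub ho
        rw [← integral_sub (s.integrable_backlog n T) ho, ← integral_add hd hi]
        refine integral_mono (hd.add hi) (s.integrable_backlog n (T + 1)) fun ω => ?_
        exact add_le_add_left (le_max_left _ _) _
      rw [hg, integral_input] at h1
      push_cast
      linarith
  have h1 := abs_le.1 (hb 0)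
  have h2 := abs_le.1 (hb T)
  linarith [h1.2, h2.1]

end Network

/-! ### Stability and its converses, queue by queue. -/

namespace Network

variable {N : ℕ} {K : Fin N → ℕ} {pbar lam : ∀ n, Fin (K n) → ℝ}
  {τ : Fin N → (Fin N → Bool) → ℝ} {Ω : Type*} [MeasurableSpace Ω] {μ : Measure Ω}
  [IsProbabilityMeasure μ]

/-- With c = r the second comparison queue has no negative drift, but its second moment grows at
most linearly, which is enough for mean rate stability on the boundary. -/
lemma tendsto_backlog (s : Network pbar lam τ μ) (n : Fin N) {u : (∀ n, Fin (K n)) → ℝ}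
    (hu : ∀ h, serviceProb pbar τ n h - serviceRate pbar lam τ n = u h - meanNext pbar lam τ u h)
    {U : ℝ} (hU : ∀ h, |u h| ≤ U) (h0 : 0 ≤ ∑ k, lam n k)
    (hle : ∑ k, lam n k ≤ serviceRate pbar lam τ n) :
    Tendsto (fun t : ℕ => (∫ ω, s.backlog t ω n ∂μ) / t) atTop (𝓝 0) := by
  set r := serviceRate pbar lam τ n with hr
  have hr0 : 0 ≤ r := h0.trans hle
  have h1 := tendsto_div_of_sq_le (integral_lindley_nonneg (μ := μ) (s.input_nonneg n))
    (fun T => (le_add_of_nonneg_right (mul_nonneg (mul_nonneg zero_le_two (sub_nonneg.2 hle))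
      (Finset.sum_nonneg fun t _ => integral_lindley_nonneg (s.input_nonneg n) t))).trans
      (s.drift_input n hr0 T))
  have h2 := tendsto_div_of_sq_le (integral_lindley_nonneg (μ := μ) (g := s.output n)
      (a := fun _ _ => r) (fun _ _ => hr0))
    (fun T => by
      have := s.drift_output n hu hU hr0 T
      rw [← hr, sub_self, mul_zero, zero_mul, add_zero] at this
      exact this)
  have h3 : Tendsto (fun T : ℕ => (∫ ω, s.backlog0 ω n ∂μ) / (T : ℝ)) atTop (𝓝 0) :=
    tendsto_const_div_atTop_nhds_zero_nat _
  have h4 := (h3.add h1).add h2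
  rw [add_zero, add_zero] at h4
  refine squeeze_zero (fun t => div_nonneg (integral_nonneg fun ω => s.backlog_nonneg n t ω)
    (Nat.cast_nonneg t)) (fun t => ?_) h4
  rw [← add_div, ← add_div]
  exact div_le_div_of_nonneg_right (s.integral_backlog_le n hr0 t) (Nat.cast_nonneg t)

lemma exists_bound_backlog (s : Network pbar lam τ μ) (n : Fin N) {u : (∀ n, Fin (K n)) → ℝ}
    (hu : ∀ h, serviceProb pbar τ n h - serviceRate pbar lam τ n = u h - meanNext pbar lam τ u h)
    {U : ℝ} (hU : ∀ h, |u h| ≤ U) (h0 : 0 ≤ ∑ k, lam n k)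
    (hlt : ∑ k, lam n k < serviceRate pbar lam τ n) :
    ∃ B : ℝ, ∀ T : ℕ, 1 ≤ T → (∑ t ∈ Finset.range T, ∫ ω, s.backlog t ω n ∂μ) / T ≤ B := by
  obtain ⟨c, hc1, hc2⟩ := exists_between hlt
  have hc0 : 0 ≤ c := h0.trans hc1.le
  have h1 := sum_div_le_of_drift (sub_pos.2 hc1) (s.drift_input n hc0)
  have h2 := sum_div_le_of_drift (sub_pos.2 hc2) (s.drift_output n hu hU hc0)
  -- The two placeholders are the bounds of `h1` and `h2`.
  refine ⟨∫ ω, s.backlog0 ω n ∂μ + _ + _, fun T hT => le_trans ?_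
    (add_le_add (add_le_add le_rfl (h1 T hT)) (h2 T hT))⟩
  have hT' : (0 : ℝ) < T := by exact_mod_cast hT
  rw [show ∫ ω, s.backlog0 ω n ∂μ = (∑ t ∈ Finset.range T, ∫ ω, s.backlog0 ω n ∂μ) / T by
    rw [Finset.sum_const, Finset.card_range, nsmul_eq_mul, mul_div_cancel_left₀ _ hT'.ne'],
    ← add_div, ← add_div, ← Finset.sum_add_distrib, ← Finset.sum_add_distrib]
  exact div_le_div_of_nonneg_right
    (Finset.sum_le_sum fun t _ => s.integral_backlog_le n hc0 t) hT'.le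

lemma le_serviceRate_of_tendsto (s : Network pbar lam τ μ) (n : Fin N)
    {u : (∀ n, Fin (K n)) → ℝ}
    (hu : ∀ h, serviceProb pbar τ n h - serviceRate pbar lam τ n = u h - meanNext pbar lam τ u h)
    {U : ℝ} (hU : ∀ h, |u h| ≤ U)
    (ht : Tendsto (fun t : ℕ => (∫ ω, s.backlog t ω n ∂μ) / t) atTop (𝓝 0)) :
    ∑ k, lam n k ≤ serviceRate pbar lam τ n := by
  have h1 : Tendsto (fun T : ℕ => (∑ k, lam n k - serviceRate pbar lam τ n) - 2 * U / (T : ℝ))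
      atTop (𝓝 ((∑ k, lam n k - serviceRate pbar lam τ n) - 0)) :=
    tendsto_const_nhds.sub (tendsto_const_div_atTop_nhds_zero_nat _)
  have h2 := le_of_tendsto_of_tendsto h1 ht (by
    filter_upwards [eventually_ge_atTop 1] with T hT
    have hT' : (0 : ℝ) < T := by exact_mod_cast hT
    rw [le_div_iff₀ hT', sub_mul, div_mul_cancel₀ _ hT'.ne']
    exact s.le_integral_backlog n hu hU T)
  linarith

/-- A positive deficit makes the summed mean backlogs grow quadratically, so their averages are
unbounded. -/
lemma le_serviceRate_of_bound (s : Network pbar lam τ μ) (n : Fin N)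
    {u : (∀ n, Fin (K n)) → ℝ}
    (hu : ∀ h, serviceProb pbar τ n h - serviceRate pbar lam τ n = u h - meanNext pbar lam τ u h)
    {U : ℝ} (hU : ∀ h, |u h| ≤ U)
    (hb : ∃ B : ℝ, ∀ T : ℕ, 1 ≤ T →
      (∑ t ∈ Finset.range T, ∫ ω, s.backlog t ω n ∂μ) / T ≤ B) :
    ∑ k, lam n k ≤ serviceRate pbar lam τ n := by
  obtain ⟨B, hB⟩ := hb
  by_contra! hlt
  set δ := ∑ k, lam n k - serviceRate pbar lam τ n with hδ
  have hδ0 : 0 < δ := sub_pos.2 hlt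
  have hsum : ∀ T : ℕ, δ * (T * (T - 1) / 2) - 2 * U * T ≤
      ∑ t ∈ Finset.range T, ∫ ω, s.backlog t ω n ∂μ := by
    intro T
    induction T with
    | zero => simp
    | succ T ih =>
      rw [Finset.sum_range_succ]
      push_cast
      linarith [s.le_integral_backlog n hu hU T]
  -- At horizon T + 1 the average is at least δT/2 - 2U, which exceeds `B` for this T.
  obtain ⟨T, hT⟩ := exists_nat_gt ((B + 2 * U) * 2 / δ)
  have h1 := hB (T + 1) (by omega)
  have hT' : (0 : ℝ) < (T : ℝ) + 1 := by positivity
  have h2 := hsum (T + 1)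
  push_cast at h1 h2
  rw [div_le_iff₀ hT'] at h1
  rw [div_lt_iff₀ hδ0] at hT
  nlinarith [mul_pos hT' (sub_pos.2 hT)]

end Network

section Main

variable {N : ℕ} {K : Fin N → ℕ} {pbar lam : ∀ n, Fin (K n) → ℝ}
  {τ : Fin N → (Fin N → Bool) → ℝ}

lemma serviceRate_eq_zero {n : Fin N} (hdead : ∀ S : Fin N → Bool, onIndicator (S n) * τ n S = 0) :
    serviceRate pbar lam τ n = 0 := by
  simp [serviceRate, hdead]

/-- The Poisson equation of a queue that is never served. -/
lemma poisson_of_dead (hlam : IsTraffic lam) {n : Fin N}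
    (hdead : ∀ S : Fin N → Bool, onIndicator (S n) * τ n S = 0) (h : ∀ n, Fin (K n)) :
    serviceProb pbar τ n h - serviceRate pbar lam τ n =
      (fun _ => (0 : ℝ)) h - meanNext pbar lam τ (fun _ => 0) h := by
  rw [meanNext_const hlam, serviceRate_eq_zero hdead]
  simp [serviceProb, hdead]

lemma exists_abs_le (u : (∀ n, Fin (K n)) → ℝ) : ∃ U, ∀ h, |u h| ≤ U := by
  obtain ⟨U, hU⟩ := (Set.finite_range fun h => |u h|).bddAbove
  exact ⟨U, fun h => hU ⟨h, rfl⟩⟩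

lemma forall_le_serviceRate {Ω : Type*} [MeasurableSpace Ω] {μ : Measure Ω}
    [IsProbabilityMeasure μ] (hpbar : ∀ n k, 0 < pbar n k ∧ pbar n k ≤ 1)
    (hτ : IsQueueStatePolicy τ) (hlam : IsTraffic lam) (hreg : IsRegular pbar lam τ)
    (s : Network pbar lam τ μ) :
    (s.IsStable ↔ ∀ n, ∑ k, lam n k ≤ serviceRate pbar lam τ n) ∧
      (s.IsStronglyStable → ∀ n, ∑ k, lam n k ≤ serviceRate pbar lam τ n) ∧
      ((∀ n, ∑ k, lam n k < serviceRate pbar lam τ n) → s.IsStronglyStable) := by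
  rcases exists_poisson_or_dead hpbar hτ hlam hreg with hu | ⟨n, hdead⟩
  · choose u hu using hu
    choose U hU using fun n => exists_abs_le (u n)
    exact ⟨⟨fun h n => s.le_serviceRate_of_tendsto n (hu n) (hU n) (h n).2,
      fun h n => ⟨s.integrable_backlog n,
        s.tendsto_backlog n (hu n) (hU n) (hlam.2 n).le (h n)⟩⟩,
      fun h n => s.le_serviceRate_of_bound n (hu n) (hU n) (h n).2,
      fun h n => ⟨s.integrable_backlog n,
        s.exists_bound_backlog n (hu n) (hU n) (hlam.2 n).le (h n)⟩⟩
  -- For the queue that is never served u = 0 solves the Poisson equation, so the converse lemmas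
  -- apply to it, and this one queue decides all three claims.
  · have hpos := hlam.2 n
    have hu := poisson_of_dead (pbar := pbar) hlam hdead
    have hU : ∀ h : ∀ n, Fin (K n), |(fun _ => (0 : ℝ)) h| ≤ 0 := by simp
    have hnot : ¬ ∑ k, lam n k ≤ serviceRate pbar lam τ n := by
      rw [serviceRate_eq_zero hdead]; exact not_le.2 hpos
    exact ⟨⟨fun h => absurd (s.le_serviceRate_of_tendsto n hu hU (h n).2) hnot,
      fun h => absurd (h n) hnot⟩,
      fun h => absurd (s.le_serviceRate_of_bound n hu hU (h n).2) hnot,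
      fun h => absurd (h n).le hnot⟩

end Main

/-! ### Existence of a realization. -/

section Realization

/-- The law on a finite type with given weights. -/
noncomputable def finLaw {X : Type*} [Fintype X] [MeasurableSpace X] (w : X → ℝ) : Measure X :=
  ∑ x, ENNReal.ofReal (w x) • Measure.dirac x

lemma isProbabilityMeasure_finLaw {X : Type*} [Fintype X] [MeasurableSpace X] {w : X → ℝ}
    (h0 : ∀ x, 0 ≤ w x) (h1 : ∑ x, w x = 1) : IsProbabilityMeasure (finLaw w) := by
  constructor
  simp only [finLaw, Measure.finsetSum_apply, Measure.smul_apply, measure_univ, smul_eq_mul,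
    mul_one]
  rw [← ENNReal.ofReal_sum_of_nonneg fun x _ => h0 x, h1, ENNReal.ofReal_one]

lemma finLaw_real_singleton {X : Type*} [Fintype X] [MeasurableSpace X]
    [MeasurableSingletonClass X] {w : X → ℝ} (h0 : ∀ x, 0 ≤ w x) (x : X) :
    (finLaw w).real {x} = w x := by
  classical
  rw [measureReal_def]
  simp only [finLaw, Measure.finsetSum_apply, Measure.smul_apply, smul_eq_mul,
    Measure.dirac_apply' _ (measurableSet_singleton x)]
  rw [Finset.sum_eq_single x]
  · simp [h0 x]
  · intro y _ hy
    simp [hy]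
  · simp

/-- Used to lift independence within one slot to the space of slot sequences. -/
lemma indepFun_comp_measurePreserving {A B X Y : Type*} [MeasurableSpace A] [MeasurableSpace B]
    [MeasurableSpace X] [MeasurableSpace Y] {μ : Measure A} {ν : Measure B} {e : A → B}
    (he : MeasurePreserving e μ ν) {f : B → X} {g : B → Y} (hf : Measurable f)
    (hg : Measurable g) (h : IndepFun f g ν) : IndepFun (fun a => f (e a)) (fun a => g (e a)) μ := by
  rw [indepFun_iff_measure_inter_preimage_eq_mul] at h ⊢
  intro s t hs ht
  have := h s t hs ht
  rw [← he.measure_preimage ((hf hs).inter (hg ht)).nullMeasurableSet,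
    ← he.measure_preimage (hf hs).nullMeasurableSet,
    ← he.measure_preimage (hg ht).nullMeasurableSet] at this
  exact this

lemma iIndepFun_comp_measurePreserving {ι A B : Type*} {X : ι → Type*} [MeasurableSpace A]
    [MeasurableSpace B] [∀ i, MeasurableSpace (X i)] {μ : Measure A} {ν : Measure B} {e : A → B}
    (he : MeasurePreserving e μ ν) {f : ∀ i, B → X i} (hf : ∀ i, Measurable (f i))
    (h : iIndepFun f ν) : iIndepFun (fun i a => f i (e a)) μ := by
  rw [iIndepFun_iff_measure_inter_preimage_eq_mul] at h ⊢
  intro S sets hs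
  have := h S hs
  rw [← he.measure_preimage (Finset.measurableSet_biInter S fun i hi =>
      hf i (hs i hi)).nullMeasurableSet,
    Finset.prod_congr rfl fun i hi => (he.measure_preimage
      (hf i (hs i hi)).nullMeasurableSet).symm] at this
  simp only [Set.preimage_iInter] at this
  exact this

/-- One slot of a realization: link states, scheduled queue (`0` for none) in each joint state,
and new heads. -/
abbrev Slot {N : ℕ} (K : Fin N → ℕ) : Type :=
  (∀ n, Fin (K n) → Bool) × ((Fin N → Bool) → Fin (N + 1)) × (∀ n, Fin (K n))

variable {N : ℕ} {K : Fin N → ℕ}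

/-- Weights of the scheduled queue in the joint state `S`. -/
noncomputable def grantWeight (τ : Fin N → (Fin N → Bool) → ℝ) (S : Fin N → Bool) :
    Fin (N + 1) → ℝ :=
  Fin.cons (1 - ∑ n, τ n S) fun n => τ n S

/-- ON and OFF weights of a link. -/
def linkWeight (p : ℝ) (b : Bool) : ℝ := if b then p else 1 - p

/-- Law of the link states. -/
noncomputable def chanLaw (pbar : ∀ n, Fin (K n) → ℝ) : Measure (∀ n, Fin (K n) → Bool) :=
  Measure.pi fun n => Measure.pi fun k => finLaw (linkWeight (pbar n k))

/-- Law of the scheduling decisions. -/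
noncomputable def grantLaw (τ : Fin N → (Fin N → Bool) → ℝ) :
    Measure ((Fin N → Bool) → Fin (N + 1)) :=
  Measure.pi fun S => finLaw (grantWeight τ S)

/-- Law of the new heads. -/
noncomputable def freshLaw (lam : ∀ n, Fin (K n) → ℝ) : Measure (∀ n, Fin (K n)) :=
  Measure.pi fun n => finLaw (alpha lam n)

lemma grantWeight_nonneg {τ : Fin N → (Fin N → Bool) → ℝ} (hτ : IsQueueStatePolicy τ)
    (S : Fin N → Bool) (i : Fin (N + 1)) : 0 ≤ grantWeight τ S i := by
  refine Fin.cases ?_ (fun n => ?_) i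
  · exact sub_nonneg.2 (hτ.2 S)
  · exact hτ.1 n S

/-- Every set of parameters is realized, with arrivals that are constant in time. -/
lemma exists_network {pbar lam : ∀ n, Fin (K n) → ℝ} {τ : Fin N → (Fin N → Bool) → ℝ}
    (hpbar : ∀ n k, 0 < pbar n k ∧ pbar n k ≤ 1) (hτ : IsQueueStatePolicy τ)
    (hlam : IsTraffic lam) :
    ∃ μ : Measure (ℕ → Slot K), IsProbabilityMeasure μ ∧ Nonempty (Network pbar lam τ μ) := by
  have hlink0 : ∀ n k b, 0 ≤ linkWeight (pbar n k) b := by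
    intro n k b
    have := hpbar n k
    cases b <;> simp only [linkWeight, if_true, Bool.false_eq_true, if_false] <;> linarith
  have i1 : ∀ n k, IsProbabilityMeasure (finLaw (linkWeight (pbar n k))) := fun n k =>
    isProbabilityMeasure_finLaw (hlink0 n k) (by simp [linkWeight])
  have i2 : ∀ S, IsProbabilityMeasure (finLaw (grantWeight τ S)) := fun S =>
    isProbabilityMeasure_finLaw (grantWeight_nonneg hτ S) (by simp [grantWeight, Fin.sum_univ_succ])
  have i3 : ∀ n, IsProbabilityMeasure (finLaw (alpha lam n)) := fun n =>
    isProbabilityMeasure_finLaw (alpha_nonneg hlam n) (sum_alpha hlam n)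
  have j1 : IsProbabilityMeasure (chanLaw pbar) := by unfold chanLaw; infer_instance
  have j2 : IsProbabilityMeasure (grantLaw τ) := by unfold grantLaw; infer_instance
  have j3 : IsProbabilityMeasure (freshLaw lam) := by unfold freshLaw; infer_instance
  obtain ⟨h0, -⟩ := exists_pos hlam
  set ν : Measure (Slot K) := (chanLaw pbar).prod ((grantLaw τ).prod (freshLaw lam)) with hν
  set μ : Measure (ℕ → Slot K) := Measure.infinitePi fun _ => ν with hμ
  have eval : ∀ t, MeasurePreserving (fun ω : ℕ → Slot K => ω t) μ ν :=
    fun t => measurePreserving_eval_infinitePi (fun _ => ν) t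
  have echan : ∀ t, MeasurePreserving (fun ω : ℕ → Slot K => (ω t).1) μ (chanLaw pbar) :=
    fun t => measurePreserving_fst.comp (eval t)
  have esnd : ∀ t, MeasurePreserving (fun ω : ℕ → Slot K => (ω t).2) μ
    ((grantLaw τ).prod (freshLaw lam)) := fun t => measurePreserving_snd.comp (eval t)
  have elink : ∀ t n k, MeasurePreserving (fun ω : ℕ → Slot K => (ω t).1 n k) μ
      (finLaw (linkWeight (pbar n k))) := fun t n k =>
    (measurePreserving_eval (fun k => finLaw (linkWeight (pbar n k))) k).comp
      ((measurePreserving_eval (fun n => Measure.pi fun k => finLaw (linkWeight (pbar n k)))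
        n).comp (echan t))
  have egrant : ∀ t S, MeasurePreserving (fun ω : ℕ → Slot K => (ω t).2.1 S) μ
      (finLaw (grantWeight τ S)) := fun t S =>
    (measurePreserving_eval (fun S => finLaw (grantWeight τ S)) S).comp
      (measurePreserving_fst.comp (esnd t))
  have efresh : ∀ t n, MeasurePreserving (fun ω : ℕ → Slot K => (ω t).2.2 n) μ
      (finLaw (alpha lam n)) := fun t n =>
    (measurePreserving_eval (fun n => finLaw (alpha lam n)) n).comp
      (measurePreserving_snd.comp (esnd t))
  -- Queue `n` is coded by `n.succ`, so a single value per joint state can grant at most one queue,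
  -- at every sample point.
  have hdec : Measurable fun (o : (Fin N → Bool) → Fin (N + 1)) (S : Fin N → Bool) (n : Fin N) =>
    decide (o S = n.succ) := Measurable.of_discrete
  have hgrant : ∀ t, Measurable fun (ω : ℕ → Slot K) (S : Fin N → Bool) (n : Fin N) =>
      decide ((ω t).2.1 S = n.succ) := fun t =>
    hdec.comp (esnd t).measurable.fst
  have hcg : ∀ t, IndepFun (fun ω : ℕ → Slot K => (ω t).1)
      (fun ω => ((fun S n => decide ((ω t).2.1 S = n.succ) : (Fin N → Bool) → Fin N → Bool),
        (ω t).2.2)) μ := fun t =>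
    indepFun_comp_measurePreserving (eval t) (f := Prod.fst)
      (g := fun d => ((fun S n => decide (d.2.1 S = n.succ) : (Fin N → Bool) → Fin N → Bool),
        d.2.2)) measurable_fst
      ((hdec.comp measurable_snd.fst).prodMk measurable_snd.snd)
      (indepFun_prod (X := id) (Y := fun d : ((Fin N → Bool) → Fin (N + 1)) × (∀ n, Fin (K n)) =>
        ((fun S n => decide (d.1 S = n.succ) : (Fin N → Bool) → Fin N → Bool), d.2))
        measurable_id ((hdec.comp measurable_fst).prodMk measurable_snd))
  have hgf : ∀ t, IndepFun (fun (ω : ℕ → Slot K) (S : Fin N → Bool) (n : Fin N) =>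
      decide ((ω t).2.1 S = n.succ)) (fun ω => (ω t).2.2) μ := fun t =>
    indepFun_comp_measurePreserving (esnd t)
      (f := fun d (S : Fin N → Bool) (n : Fin N) => decide (d.1 S = n.succ)) (g := Prod.snd)
      (hdec.comp measurable_fst) measurable_snd
      (indepFun_prod (X := fun (o : (Fin N → Bool) → Fin (N + 1)) (S : Fin N → Bool) (n : Fin N) =>
          decide (o S = n.succ))
        (Y := id) hdec measurable_id)
  refine ⟨μ, inferInstance, ⟨{
    arr := fun _ _ => lam
    chan := fun t ω => (ω t).1
    grant := fun t ω S n => decide ((ω t).2.1 S = n.succ)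
    fresh := fun t ω => (ω t).2.2
    hol0 := fun _ => h0
    backlog0 := fun _ _ => 0
    measurable_arr := fun _ => measurable_const
    measurable_chan := fun t => (echan t).measurable
    measurable_grant := hgrant
    measurable_fresh := fun t => (esnd t).measurable.snd
    measurable_hol0 := measurable_const
    backlog0_nonneg := fun _ _ => le_rfl
    integrable_backlog0 := fun _ => integrable_const _
    arr_nonneg := fun _ _ n k => hlam.1 n k
    arr_indep := iIndepFun_infinitePi (P := fun _ : ℕ => ν) (X := fun _ _ => lam)
      fun _ => measurable_const
    arr_ident := fun _ => IdentDistrib.refl measurable_const.aemeasurable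
    arr_memLp := fun _ _ _ => memLp_const _
    arr_mean := fun _ _ _ => by simp
    drive_indep := iIndepFun_infinitePi (P := fun _ : ℕ => ν)
      (X := fun _ d => (d.1, (fun S n => decide (d.2.1 S = n.succ) :
        (Fin N → Bool) → Fin N → Bool), d.2.2))
      fun _ => measurable_fst.prodMk ((hdec.comp measurable_snd.fst).prodMk measurable_snd.snd)
    hol0_indep := indepFun_const_left _ _
    chan_prob := fun t n k => ((elink t n k).measureReal_preimage
      (measurableSet_singleton true).nullMeasurableSet).trans
        (finLaw_real_singleton (hlink0 n k) true)
    chan_indep := fun t => iIndepFun_comp_measurePreserving (echan t)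
      (f := fun n c => c n) (fun n => measurable_pi_apply n)
      (iIndepFun_pi (X := fun _ => id) fun _ => aemeasurable_id)
    grant_unique := fun t ω S n m hn hm => by
      rw [decide_eq_true_eq] at hn hm
      exact Fin.succ_injective _ (hn.symm.trans hm)
    grant_prob := fun t S n => by
      simp only [decide_eq_true_eq]
      exact ((egrant t S).measureReal_preimage
        (measurableSet_singleton n.succ).nullMeasurableSet).trans
        (finLaw_real_singleton (grantWeight_nonneg hτ S) n.succ)
    grant_indep := fun t => (hcg t).comp measurable_id measurable_fst
    fresh_prob := fun t n k => ((efresh t n).measureReal_preimage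
      (measurableSet_singleton k).nullMeasurableSet).trans
        (finLaw_real_singleton (alpha_nonneg hlam n) k)
    fresh_indep := fun t => indepFun_prodMk_left_of_prodMk_right (echan t).measurable (hgrant t)
      (esnd t).measurable.snd (hcg t) (hgf t) }⟩⟩

end Realization

end FifoWireless

theorem theorem2 {N : ℕ} {K : Fin N → ℕ} (pbar : ∀ n, Fin (K n) → ℝ)
    (hpbar : ∀ n k, 0 < pbar n k ∧ pbar n k ≤ 1)
    (τ : Fin N → (Fin N → Bool) → ℝ) (hτ : FifoWireless.IsQueueStatePolicy τ) :
    FifoWireless.stabilityRegion pbar τ =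
        {lam | FifoWireless.IsTraffic lam ∧ FifoWireless.IsRegular pbar lam τ ∧
          ∀ n k, lam n k ≤ FifoWireless.rateBound pbar lam τ n k} ∧
      ∀ lam : ∀ n, Fin (K n) → ℝ,
        FifoWireless.IsTraffic lam → FifoWireless.IsRegular pbar lam τ →
        ∀ (Ω : Type*) [MeasurableSpace Ω] (μ : MeasureTheory.Measure Ω)
          [MeasureTheory.IsProbabilityMeasure μ] (s : FifoWireless.Network pbar lam τ μ),
          (s.IsStable ↔ ∀ n k, lam n k ≤ FifoWireless.rateBound pbar lam τ n k) ∧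
          (s.IsStronglyStable → ∀ n k, lam n k ≤ FifoWireless.rateBound pbar lam τ n k) ∧
          ((∀ n k, 0 < lam n k → lam n k < FifoWireless.rateBound pbar lam τ n k) →
            s.IsStronglyStable) := by
  constructor
  · ext lam
    constructor
    · rintro ⟨hlam, hreg, h⟩
      -- Membership in the region quantifies over all realizations; it would be vacuous if there
      -- were none.
      obtain ⟨μ, hμ, ⟨s⟩⟩ := FifoWireless.exists_network hpbar hτ hlam
      refine ⟨hlam, hreg, fun n => ?_⟩
      rw [FifoWireless.le_rateBound_iff hlam]
      exact (FifoWireless.forall_le_serviceRate hpbar hτ hlam hreg s).1.1 (h _ μ s) n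
    · rintro ⟨hlam, hreg, h⟩
      refine ⟨hlam, hreg, fun Ω _ μ _ s => ?_⟩
      exact (FifoWireless.forall_le_serviceRate hpbar hτ hlam hreg s).1.2
        fun n => (FifoWireless.le_rateBound_iff hlam n).1 (h n)
  · intro lam hlam hreg Ω _ μ _ s
    obtain ⟨h1, h2, h3⟩ := FifoWireless.forall_le_serviceRate hpbar hτ hlam hreg s
    simp only [FifoWireless.le_rateBound_iff hlam]
    exact ⟨h1, h2, fun h => h3 fun n => FifoWireless.sum_lt_serviceRate hlam n (h n)⟩
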